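/- Let $k$ be a field, $A$ a finite-dimensional $k$-algebra and $(\Lambda,\leqslant)$ a finite poset. All $A$-modules below are finitely generated left modules, and maps are composed from right to left. Let $\underline\Theta=\{\Theta_\lambda\}_{\lambda\in\Lambda}$ be nonzero $A$-modules and $\underline Q=\{Q_\lambda\}_{\lambda\in\Lambda}$ indecomposable $A$-modules. Write $\mathcal F(\Theta)$ for the class of modules that have a finite filtration with every factor isomorphic to some $\Theta_\lambda$. Suppose that $(\underline\Theta,\underline Q)$ is an *Ext-projective stratifying system*, that is: 1. $\operatorname{Hom}_A(\Theta_\lambda,\Theta_\mu)=0$ if $\lambda\nleqslant\mu$; 2. for each $\lambda\in\Lambda$ there is an exact sequence $0\to K_\lambda\to Q_\lambda\to\Theta_\lambda\to 0$ such that $K_\lambda$ has a filtration all of whose factors are isomorphic to modules $\Theta_\mu$ with $\mu>\lambda$; 3. $\operatorname{Ext}^1_A(Q_\lambda,M)=0$ for every $M\in\mathcal F(\Theta)$ and every $\lambda\in\Lambda$. Let $\Theta=\bigoplus_\lambda\Theta_\lambda$ and $Q=\bigoplus_\lambda Q_\lambda$, and suppose that $\operatorname{Ext}^i_A(Q,\Theta)=0$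 for all $i\geqslant1$. Let $\mathcal E$ be the $k$-linear category associated to the extension algebra $\operatorname{Ext}^*_A(\Theta,\Theta)$: its objects are the $\lambda\in\Lambda$ (standing for $\Theta_\lambda$), $\mathcal E(\lambda,\mu)=\bigoplus_{s\geqslant0}\operatorname{Ext}^s_A(\Theta_\lambda,\Theta_\mu)$, and composition is the Yoneda product. For a partial order $\preccurlyeq$ on $\Lambda$: - $\mathcal E$ is *directed* for $\preccurlyeq$ if $\mathcal E(\lambda,\mu)=0$ unless $\lambda\preccurlyeq\mu$. - $\mathcal E$ is *standardly stratified* for $\preccurlyeq$ if the algebra $\Gamma=\bigoplus_{\lambda,\mu}\mathcal E(\lambda,\mu)$, with the multiplication induced by composition, satisfies the following. It is finite-dimensional over $k$. The left modules $P_\lambda=\Gamma 1_\lambda=\bigoplus_\mu\mathcal E(\lambda,\mu)$ are projective covers of simple modules $S_\lambda$ such that every simple $\Gamma$-module is isomorphic to $S_\lambda$ for exactly one $\lambda\in\Lambda$. There are $\Gamma$-modules $\Delta_\lambda$ $(\lambda\in\Lambda)$ with composition multiplicity $[\Delta_\lambda:S_\mu]=0$ whenever $\mu\not\preccurlyeq\lambda$,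 and exact sequences $0\to K_\lambda'\to P_\lambda\to\Delta_\lambda\to0$ in which $K_\lambda'$ has a filtration all of whose factors are isomorphic to modules $\Delta_\mu$ with $\lambda\prec\mu$. **Theorem.** The category $\mathcal E$ is directed for $\leqslant$ and standardly stratified for $\leqslant^{op}$. Moreover, $\mathcal E$ is standardly stratified for $\leqslant$ if and only if, for all $s\geqslant0$ and all $\lambda,\mu\in\Lambda$, $\operatorname{Ext}^s_A(\Theta_\lambda,\Theta_\mu)$ is a projective left $\operatorname{End}_A(\Theta_\mu)$-module, where $\operatorname{End}_A(\Theta_\mu)$ acts by composition. -/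

import Mathlib

open CategoryTheory CategoryTheory.Abelian CategoryTheory.Limits

universe u v w

namespace ExtStrat

/-! ### Filtrations, composition factors, projective covers -/

/-- `M` has a finite filtration `0 = N 0 ⊆ N 1 ⊆ ⋯ ⊆ N n = M` by submodules, each factor of which
is isomorphic to some `F i` with `i ∈ I`. The zero module has one, with `n = 0`. -/
def HasFiltration (R : Type u) [Ring R] {ι : Type w} (F : ι → ModuleCat.{v} R) (I : Set ι)
    (M : Type v) [AddCommGroup M] [Module R M] : Prop :=
  ∃ (n : ℕ) (N : Fin (n + 1) → Submodule R M),
    N 0 = ⊥ ∧ N (Fin.last n) = ⊤ ∧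
    ∀ j : Fin n, N j.castSucc ≤ N j.succ ∧
      ∃ i ∈ I, Nonempty ((N j.succ ⧸ (N j.castSucc).submoduleOf (N j.succ)) ≃ₗ[R] F i)

/-- `S` is isomorphic to a subquotient of `M`. For `S` simple and `M` of finite length this says
that the composition factor multiplicity `[M : S]` is nonzero. -/
def IsCompositionFactor (R : Type u) [Ring R] (M S : Type v) [AddCommGroup M] [Module R M]
    [AddCommGroup S] [Module R S] : Prop :=
  ∃ N₁ N₂ : Submodule R M, N₁ ≤ N₂ ∧ Nonempty ((N₂ ⧸ N₁.submoduleOf N₂) ≃ₗ[R] S)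

/-- `p : P → S` is a projective cover: `P` is projective, `p` is onto, its kernel is superfluous. -/
structure IsProjectiveCover {R : Type u} [Ring R] {P S : Type v} [AddCommGroup P] [Module R P]
    [AddCommGroup S] [Module R S] (p : P →ₗ[R] S) : Prop where
  projective : Module.Projective R P
  surjective : Function.Surjective p
  superfluous : ∀ N : Submodule R P, N ⊔ LinearMap.ker p = ⊤ → N = ⊤

/-! ### Ext-projective stratifying systems -/

/-- `(Θ, Q)` is an Ext-projective stratifying system of (finitely generated) `A`-modules indexed
by the poset `Λ`. -/
structure IsEPSS (A : Type u) [Ring A] {Λ : Type w} [PartialOrder Λ]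
    (Θ Q : Λ → ModuleCat.{u} A) : Prop where
  finite_left : ∀ i, Module.Finite A (Θ i)
  finite_right : ∀ i, Module.Finite A (Q i)
  nonzero : ∀ i, Nontrivial (Θ i)
  indecomposable : ∀ i, Indecomposable (Q i)
  hom_eq_zero : ∀ i j, ¬ i ≤ j → ∀ f : Θ i ⟶ Θ j, f = 0
  exists_cover : ∀ i, ∃ q : Q i →ₗ[A] Θ i, Function.Surjective q ∧
    HasFiltration A Θ {j | i < j} (LinearMap.ker q)
  ext_one_eq_zero : ∀ M : ModuleCat.{u} A, HasFiltration A Θ Set.univ M →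
    ∀ i, ∀ x : Ext (Q i) M 1, x = 0

/-! ### Standardly stratified algebras -/

/-- The `k`-algebra `B` is finite-dimensional and standardly stratified for the partial order `r`
on `Λ`, where the `P i` are its indecomposable projective modules. That is: the index set
parametrizes the simple `B`-modules `S i` up to isomorphism, `P i` is the projective cover of `S i`,
and there are modules `Δ i` such that `[Δ i : S j] = 0` unless `r j i`, together with short exact
sequences `0 → K i → P i → Δ i → 0` where `K i` is filtered by modules `Δ j` with `j` strictly
above `i`. -/
structure IsStandardlyStratified (k : Type u) [Field k] (B : Type v) [Ring B] [Algebra k B]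
    {Λ : Type w} (r : Λ → Λ → Prop) [IsPartialOrder Λ r] (P : Λ → ModuleCat.{v} B) : Prop where
  finite : Module.Finite k B
  exists_standard : ∃ S Δ : Λ → ModuleCat.{v} B,
    (∀ i, IsSimpleModule B (S i)) ∧
    (∀ i j, Nonempty (S i ≃ₗ[B] S j) → i = j) ∧
    (∀ T : ModuleCat.{v} B, IsSimpleModule B T → ∃ i, Nonempty (T ≃ₗ[B] S i)) ∧
    (∀ i, ∃ p : P i →ₗ[B] S i, IsProjectiveCover p) ∧
    (∀ i j, ¬ r j i → ¬ IsCompositionFactor B (Δ i) (S j)) ∧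
    (∀ i, ∃ q : P i →ₗ[B] Δ i, Function.Surjective q ∧
      HasFiltration B Δ {j | r i j ∧ i ≠ j} (LinearMap.ker q))

/-! ### Linear categories with finitely many objects and their associated algebras -/

/-- There are no nonzero morphisms `x ⟶ y` unless `x` is below `y`. -/
def IsDirectedCategory (C : Type w) [Category.{v} C] [Preadditive C] (r : C → C → Prop)
    [IsPartialOrder C r] : Prop :=
  ∀ x y : C, ¬ r x y → ∀ f : x ⟶ y, f = 0

/-- The associated algebra `⨁ x y, C(x, y)` of a preadditive category with finitely many objects. -/
def AssocAlgebra (C : Type w) [Category.{v} C] : Type (max w v) :=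
  ∀ x y : C, x ⟶ y

namespace AssocAlgebra

variable (C : Type w) [Category.{v} C] [Preadditive C]

instance : AddCommGroup (AssocAlgebra C) :=
  inferInstanceAs (AddCommGroup (∀ x y : C, x ⟶ y))

variable {C}

/-- The identity of `x`, as an element of the associated algebra. -/
def idem [DecidableEq C] (x : C) : AssocAlgebra C := fun y z =>
  if h : y = x ∧ x = z then eqToHom (h.1.trans h.2) else 0

variable [Fintype C] [DecidableEq C]

/-- Morphisms are composed from right to left: `f * g` is first `g`, then `f`. The unit is the sum
of the identities of all objects. -/
instance : Ring (AssocAlgebra C) where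
  __ := (inferInstance : AddCommGroup (AssocAlgebra C))
  mul f g := fun x z => ∑ y, g x y ≫ f y z
  one := fun x y => if h : x = y then eqToHom h else 0
  mul_assoc f g h := by
    funext x z
    change ∑ y, h x y ≫ (∑ t, g y t ≫ f t z) = ∑ t, (∑ y, h x y ≫ g y t) ≫ f t z
    simp only [Preadditive.comp_sum, Preadditive.sum_comp, Category.assoc]
    exact Finset.sum_comm
  one_mul f := by
    funext x z
    change ∑ y, f x y ≫ (if h : y = z then eqToHom h else 0) = f x z
    rw [Finset.sum_eq_single z] <;> simp +contextual
  mul_one f := by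
    funext x z
    change ∑ y, (if h : x = y then eqToHom h else 0) ≫ f y z = f x z
    rw [Finset.sum_eq_single x]
    · simp
    · intro y _ hy
      simp [Ne.symm hy]
    · simp
  zero_mul f := by
    funext x z
    change ∑ y, f x y ≫ (0 : y ⟶ z) = 0
    simp
  mul_zero f := by
    funext x z
    change ∑ y, (0 : x ⟶ y) ≫ f y z = 0
    simp
  left_distrib f g h := by
    funext x z
    change ∑ y, (g x y + h x y) ≫ f y z = (∑ y, g x y ≫ f y z) + ∑ y, h x y ≫ f y z
    simp [Finset.sum_add_distrib]
  right_distrib f g h := by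
    funext x z
    change ∑ y, h x y ≫ (f y z + g y z) = (∑ y, h x y ≫ f y z) + ∑ y, h x y ≫ g y z
    simp [Finset.sum_add_distrib]

variable (k : Type u) [Field k] [Linear k C]

instance : Module k (AssocAlgebra C) :=
  inferInstanceAs (Module k (∀ x y : C, x ⟶ y))

instance : Algebra k (AssocAlgebra C) :=
  Algebra.ofModule
    (fun a f g => by
      funext x z
      change ∑ y, g x y ≫ (a • f y z) = a • ∑ y, g x y ≫ f y z
      simp [Finset.smul_sum])
    (fun a f g => by
      funext x z
      change ∑ y, (a • g x y) ≫ f y z = a • ∑ y, g x y ≫ f y z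
      simp [Finset.smul_sum])

/-- The projective left module generated by the idempotent of `x`, that is `⨁ y, C(x, y)`. -/
def proj (x : C) : ModuleCat.{max w v} (AssocAlgebra C) :=
  ModuleCat.of (AssocAlgebra C) (Submodule.span (AssocAlgebra C) {idem x})

end AssocAlgebra

/-- A `k`-linear category with finitely many objects is standardly stratified for a partial order
on its objects if its associated algebra is, the indecomposable projectives being `⨁ y, C(x, y)`. -/
def IsStandardlyStratifiedCategory (k : Type u) [Field k] (C : Type w) [Category.{v} C]
    [Preadditive C] [Linear k C] [Fintype C] [DecidableEq C] (r : C → C → Prop)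
    [IsPartialOrder C r] : Prop :=
  IsStandardlyStratified k (AssocAlgebra C) r (AssocAlgebra.proj (C := C))

/-! ### The category associated to the extension algebra -/

/-- The objects of the category associated to `Ext*(Θ, Θ)`, where `Θ` is the direct sum of the
`Θ i`: one object for each index `i`, ordered as the indices are. -/
def ExtCategory {A : Type u} [Ring A] {Λ : Type w} (_Θ : Λ → ModuleCat.{u} A) : Type w := Λ

section ExtCategory

variable {A : Type u} [Ring A] {Λ : Type w} (Θ : Λ → ModuleCat.{u} A)

instance [PartialOrder Λ] : PartialOrder (ExtCategory Θ) := inferInstanceAs (PartialOrder Λ)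
instance [Fintype Λ] : Fintype (ExtCategory Θ) := inferInstanceAs (Fintype Λ)
instance [DecidableEq Λ] : DecidableEq (ExtCategory Θ) := inferInstanceAs (DecidableEq Λ)

/-- The total Ext group `⨁ s, Ext^s(X, Y)`. -/
abbrev TotalExt (X Y : ModuleCat.{u} A) : Type u := DirectSum ℕ (fun s => Ext X Y s)

namespace TotalExt

variable {X Y Z T : ModuleCat.{u} A}

/-- The Yoneda product in one pair of degrees, as a biadditive map. -/
noncomputable def compDeg (X Y Z : ModuleCat.{u} A) (s t : ℕ) :
    Ext X Y s →+ Ext Y Z t →+ TotalExt X Z :=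
  AddMonoidHom.mk' (fun x => AddMonoidHom.mk'
      (fun y => DirectSum.of (fun n => Ext X Z n) (s + t) (x.comp y rfl))
      (fun y y' => by rw [Ext.comp_add, map_add]))
    (fun x x' => by
      ext y
      simp [Ext.add_comp])

/-- The Yoneda product. -/
noncomputable def comp (X Y Z : ModuleCat.{u} A) :
    TotalExt X Y →+ TotalExt Y Z →+ TotalExt X Z :=
  DirectSum.toAddMonoid fun s =>
    (DirectSum.toAddMonoid fun t => (compDeg X Y Z s t).flip).flip

lemma comp_of (s t : ℕ) (x : Ext X Y s) (y : Ext Y Z t) :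
    comp X Y Z (DirectSum.of (fun n => Ext X Y n) s x) (DirectSum.of (fun n => Ext Y Z n) t y) =
      DirectSum.of (fun n => Ext X Z n) (s + t) (x.comp y rfl) := by
  simp [comp, compDeg]

lemma of_comp_eq {s t n : ℕ} (x : Ext X Y s) (y : Ext Y Z t) (h : s + t = n) :
    DirectSum.of (fun n => Ext X Z n) (s + t) (x.comp y rfl) =
      DirectSum.of (fun n => Ext X Z n) n (x.comp y h) := by
  subst h
  rfl

/-- The identity of `X`, in degree zero. -/
noncomputable def one (X : ModuleCat.{u} A) : TotalExt X X :=
  DirectSum.of (fun n => Ext X X n) 0 (Ext.mk₀ (𝟙 X))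

lemma one_comp (y : TotalExt X Y) : comp X X Y (one X) y = y := by
  induction y using DirectSum.induction_on with
  | zero => simp
  | of s y =>
    rw [one, comp_of, of_comp_eq _ _ (zero_add s), Ext.mk₀_id_comp]
  | add a b ha hb => rw [map_add, ha, hb]

lemma comp_one (y : TotalExt X Y) : comp X Y Y y (one Y) = y := by
  induction y using DirectSum.induction_on with
  | zero => simp
  | of s y =>
    rw [one, comp_of, of_comp_eq _ _ (add_zero s), Ext.comp_mk₀_id]
  | add a b ha hb => rw [map_add, AddMonoidHom.add_apply, ha, hb]

lemma add_comp (x x' : TotalExt X Y) (y : TotalExt Y Z) :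
    comp X Y Z (x + x') y = comp X Y Z x y + comp X Y Z x' y := by
  rw [map_add, AddMonoidHom.add_apply]

lemma comp_add (x : TotalExt X Y) (y y' : TotalExt Y Z) :
    comp X Y Z x (y + y') = comp X Y Z x y + comp X Y Z x y' := by
  rw [map_add]

lemma comp_assoc (x : TotalExt X Y) (y : TotalExt Y Z) (z : TotalExt Z T) :
    comp X Z T (comp X Y Z x y) z = comp X Y T x (comp Y Z T y z) := by
  induction x using DirectSum.induction_on with
  | zero => simp
  | add a b ha hb => simp only [map_add, AddMonoidHom.add_apply, ha, hb]
  | of s x =>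
    induction y using DirectSum.induction_on with
    | zero => simp
    | add a b ha hb => simp only [map_add, AddMonoidHom.add_apply, ha, hb]
    | of t y =>
      induction z using DirectSum.induction_on with
      | zero => simp
      | add a b ha hb => simp only [map_add, ha, hb]
      | of r z =>
        rw [comp_of, comp_of, comp_of, comp_of, of_comp_eq _ _ (add_assoc s t r),
          Ext.comp_assoc x y z rfl rfl (by omega)]

end TotalExt

/-- The category associated to `Ext*(Θ, Θ)`: morphisms from `i` to `j` are the elements of
`⨁ s, Ext^s(Θ i, Θ j)`, composed by the Yoneda product. -/
noncomputable instance : Category.{u} (ExtCategory Θ) where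
  Hom i j := TotalExt (Θ i) (Θ j)
  id i := TotalExt.one (Θ i)
  comp {i j l} x y := TotalExt.comp (Θ i) (Θ j) (Θ l) x y
  id_comp y := TotalExt.one_comp y
  comp_id y := TotalExt.comp_one y
  assoc x y z := TotalExt.comp_assoc x y z

noncomputable instance : Preadditive (ExtCategory Θ) where
  homGroup i j := (inferInstance : AddCommGroup (TotalExt (Θ i) (Θ j)))
  add_comp _ _ _ x x' y := TotalExt.add_comp x x' y
  comp_add _ _ _ x y y' := TotalExt.comp_add x y y'

variable (k : Type u) [Field k] [Algebra k A]

variable {k} in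
lemma TotalExt.smul_comp {X Y Z : ModuleCat.{u} A} (a : k) (x : TotalExt X Y)
    (y : TotalExt Y Z) : comp X Y Z (a • x) y = a • comp X Y Z x y := by
  induction x using DirectSum.induction_on with
  | zero => simp
  | add x x' hx hx' => simp only [smul_add, map_add, AddMonoidHom.add_apply, hx, hx']
  | of s x =>
    induction y using DirectSum.induction_on with
    | zero => simp
    | add y y' hy hy' => simp only [smul_add, map_add, hy, hy']
    | of t y =>
      have h1 := (DirectSum.lof k ℕ (fun n => Ext X Y n) s).map_smul a x
      have h2 := (DirectSum.lof k ℕ (fun n => Ext X Z n) (s + t)).map_smul a (x.comp y rfl)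
      simp only [DirectSum.lof_eq_of] at h1 h2
      rw [← h1, comp_of, comp_of, Ext.smul_comp, h2]

variable {k} in
lemma TotalExt.comp_smul {X Y Z : ModuleCat.{u} A} (a : k) (x : TotalExt X Y)
    (y : TotalExt Y Z) : comp X Y Z x (a • y) = a • comp X Y Z x y := by
  induction y using DirectSum.induction_on with
  | zero => simp
  | add x x' hx hx' => simp only [smul_add, map_add, hx, hx']
  | of t y =>
    induction x using DirectSum.induction_on with
    | zero => simp
    | add y y' hy hy' => simp only [smul_add, map_add, AddMonoidHom.add_apply, hy, hy']
    | of s x =>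
      have h1 := (DirectSum.lof k ℕ (fun n => Ext Y Z n) t).map_smul a y
      have h2 := (DirectSum.lof k ℕ (fun n => Ext X Z n) (s + t)).map_smul a (x.comp y rfl)
      simp only [DirectSum.lof_eq_of] at h1 h2
      rw [← h1, comp_of, comp_of, Ext.comp_smul, h2]

noncomputable instance : Linear k (ExtCategory Θ) where
  homModule i j := (inferInstance : Module k (TotalExt (Θ i) (Θ j)))
  smul_comp _ _ _ a x y := TotalExt.smul_comp a x y
  comp_smul _ _ _ x a y := TotalExt.comp_smul a x y

end ExtCategory

/-- `Ext^s(X, Y)` is a left module over the endomorphism ring of `Y` (where `f * g` is first `g`,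
then `f`), through composition with endomorphisms of `Y`. -/
noncomputable instance extModuleEnd {A : Type u} [Ring A] (X Y : ModuleCat.{u} A) (s : ℕ) :
    Module (End Y) (Ext X Y s) where
  smul f x := x.comp (Ext.mk₀ f) (add_zero s)
  one_smul x := Ext.comp_mk₀_id x
  mul_smul f g x := by
    change x.comp (Ext.mk₀ (g ≫ f)) (add_zero s) =
      (x.comp (Ext.mk₀ g) (add_zero s)).comp (Ext.mk₀ f) (add_zero s)
    rw [Ext.comp_assoc_of_third_deg_zero, Ext.mk₀_comp_mk₀]
  smul_zero f := Ext.zero_comp X s (Ext.mk₀ f) s (add_zero s)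
  smul_add f x y := Ext.add_comp _ _ _ _
  add_smul f g x := by
    change x.comp (Ext.mk₀ ((f : Y ⟶ Y) + g)) (add_zero s) = _
    rw [Ext.mk₀_add, Ext.comp_add]
    rfl
  zero_smul x := by
    change x.comp (Ext.mk₀ (0 : Y ⟶ Y)) (add_zero s) = 0
    rw [Ext.mk₀_zero, Ext.comp_zero]

end ExtStrat

/-! Write e_x for the identity of x in the associated algebra Γ and P_x = Γe_x. Since Q_i has no
positive Ext into any Θ_j, the sequence 0 → K_i → Q_i → Θ_i → 0 shifts Ext^{s+1}(Θ_i, Θ_j) to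
Ext^s(K_i, Θ_j), and K_i is filtered by Θ_l with l > i. Inductions on s give: Ext^s(Θ_i, Θ_j) = 0
for i ≰ j (`ext_eq_zero_of_not_le`), no self-extensions of Θ_i in positive degree
(`ext_succ_self_eq_zero`), and vanishing once s exceeds the number of indices above i
(`ext_eq_zero_of_card_lt`). So the Ext category is directed, has finite-dimensional morphism spaces,
and the endomorphism ring of its object i is End(Θ_i). That ring is local: End(Q_i) is, by Fitting's
lemma, endomorphisms of Θ_i lift to Q_i, and those of Q_i descend (`isLocalRing_end`).

The rest holds for any directed category C with local endomorphism rings and finite-dimensional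
morphism spaces. There f ↦ f_xx is multiplicative, so the elements of P_x with non-invertible entry
at x form its unique maximal submodule, and the simple modules are the tops of the P_x. For ≥ one
takes Δ_x = P_x, with zero kernels.

For ≤ one takes Δ_x = C(x, x), the quotient of P_x by the entries at y > x. If each C(x, y) is
projective over End(y), it is free, End(y) being local. Removing basis vectors one at a time, lowest
objects first, filters the kernel by copies of Δ_y with y > x (`hasFiltration_stdKer`).

Conversely, any stratification for ≤ satisfies e_jΔ_i = 0 for j ≠ i: by directedness if j < i, and
because S_j is not a composition factor if j ≰ i. Hence e_iK_i = 0 and e_iΔ_i ≅ e_iP_i = End(i).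
Applying the exact functor e_y to the filtration of P_x builds C(x, y) from copies of End(y) and
zeros, so it is projective (`projective_of_isStandardlyStratifiedCategory_le`). Finally, ⨁_s Ext^s
is projective exactly when every Ext^s is. -/

namespace ExtStrat

/-! ### Noncommutative local rings -/

section LocalRing

variable {D : Type*} [Ring D] [IsLocalRing D]

/-- The element ba is idempotent, and either it or 1 - ba is a unit, so ba is 1 or 0; the value 0
would give 1 = a(ba)b = 0. -/
lemma isUnit_of_mul_eq_one_of_isLocalRing {a b : D} (h : a * b = 1) : IsUnit b := by
  have hz : (1 - b * a) * (b * a) = 0 := by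
    rw [sub_mul, one_mul, mul_assoc, ← mul_assoc a, h, one_mul, sub_self]
  rcases IsLocalRing.isUnit_or_isUnit_of_add_one (sub_add_cancel 1 (b * a)) with h1 | h1
  · have h2 := (h1.mul_right_eq_zero).1 hz
    have h3 : a * (b * a) * b = 1 := by rw [← mul_assoc a, h, one_mul, h]
    rw [h2, mul_zero, zero_mul] at h3
    exact absurd h3 zero_ne_one
  · have h2 := (h1.mul_left_eq_zero).1 hz
    exact ⟨⟨b, a, (sub_eq_zero.1 h2).symm, h⟩, rfl⟩

lemma isUnit_right_of_isUnit_mul {a b : D} (h : IsUnit (a * b)) : IsUnit b := by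
  obtain ⟨u, hu⟩ := h
  refine isUnit_of_mul_eq_one_of_isLocalRing (a := ↑u⁻¹ * a) ?_
  rw [mul_assoc, ← hu, Units.inv_mul]

lemma isLocalRing_of_surjective {R : Type*} [Ring R] [Nontrivial R] (f : D →+* R)
    (hf : Function.Surjective f) : IsLocalRing R :=
  IsLocalRing.of_isUnit_or_isUnit_one_sub_self fun b => by
    obtain ⟨a, rfl⟩ := hf b
    rw [← f.map_one, ← f.map_sub]
    exact (IsLocalRing.isUnit_or_isUnit_of_add_one (add_sub_cancel a 1)).imp
      (fun h => h.map f) (fun h => h.map f)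

lemma exists_basis_of_span_eq_top (n : ℕ) : ∀ {V : Type v} [AddCommGroup V] [Module D V]
    [Module.Projective D V] (x : Fin n → V), Submodule.span D (Set.range x) = ⊤ →
    ∃ m, Nonempty (Module.Basis (Fin m) D V) := by
  induction n with
  | zero =>
    intro V _ _ _ x hx
    have : Subsingleton V := by
      rw [Set.range_eq_empty, Submodule.span_empty] at hx
      exact (Submodule.subsingleton_iff D).1 (subsingleton_of_bot_eq_top hx)
    exact ⟨0, ⟨Module.Basis.empty V⟩⟩
  | succ n ih =>
    intro V _ _ _ x hx
    have hF : Function.Surjective (Fintype.linearCombination D x) := by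
      rw [← LinearMap.range_eq_top, Fintype.range_linearCombination, hx]
    obtain ⟨s, hs⟩ := Module.projective_lifting_property _ LinearMap.id hF
    have hs' : ∀ y, ∑ i, s y i • x i = y := fun y => by
      simpa [Fintype.linearCombination_apply] using LinearMap.congr_fun hs y
    -- The section `s` writes x₀ as a combination of the generators. If its own coefficient is a
    -- unit, x₀ spans a free summand with complement `ker g`; otherwise 1 minus that coefficient is
    -- a unit and x₀ is redundant.
    by_cases hc : IsUnit (s (x 0) 0)
    · obtain ⟨c, hc⟩ := hc
      let g : V →ₗ[D] D := LinearMap.proj 0 ∘ₗ s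
      have hg : g (x 0) = c := hc.symm
      -- The projection y ↦ y - g(y)c⁻¹x₀ along x₀; it kills x₀, so `ker g` is generated by the
      -- images of the other n generators.
      let r : V →ₗ[D] LinearMap.ker g := LinearMap.codRestrict _
        (LinearMap.id - (LinearMap.toSpanSingleton D V ((↑c⁻¹ : D) • x 0)) ∘ₗ g) (fun y => by
          simp [hg])
      have hr0 : r (x 0) = 0 := by
        apply Subtype.ext
        simp [r, hg, smul_smul]
      have hr : ∀ y : LinearMap.ker g, r y = y := fun y => by
        apply Subtype.ext
        simp [r]
      have : Module.Projective D (LinearMap.ker g) :=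
        Module.Projective.of_split (LinearMap.ker g).subtype r (LinearMap.ext hr)
      obtain ⟨m, ⟨b⟩⟩ := ih (V := LinearMap.ker g) (fun i => r (x i.succ)) (by
        have h1 : Submodule.map r (Submodule.span D (Set.range x)) = ⊤ := by
          rw [hx, Submodule.map_top, LinearMap.range_eq_top]
          exact fun y => ⟨y, hr y⟩
        rw [← top_le_iff, ← h1, Submodule.map_span_le]
        rintro _ ⟨i, rfl⟩
        refine Fin.cases ?_ (fun j => ?_) i
        · rw [hr0]; exact Submodule.zero_mem _
        · exact Submodule.subset_span ⟨j, rfl⟩)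
      refine ⟨m + 1, ⟨Module.Basis.mkFinCons (x 0) b ?_ ?_⟩⟩
      · intro a y hy h
        have := congrArg g h
        rw [map_add, map_smul, hg, LinearMap.mem_ker.1 hy, add_zero, map_zero, smul_eq_mul] at this
        exact (Units.mul_left_eq_zero c).1 this
      · intro z
        refine ⟨-(g z * ↑c⁻¹), ?_⟩
        simp [hg, mul_assoc]
    · have hu : IsUnit (1 - s (x 0) 0) :=
        (IsLocalRing.isUnit_or_isUnit_of_add_one (add_sub_cancel (s (x 0) 0) 1)).resolve_left hc
      refine ih (fun i => x i.succ) ?_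
      have h0 : x 0 ∈ Submodule.span D (Set.range fun i : Fin n => x i.succ) := by
        obtain ⟨c, hc⟩ := hu
        have h1 : (c : D) • x 0 = ∑ i : Fin n, s (x 0) i.succ • x i.succ := by
          rw [hc, sub_smul, one_smul, sub_eq_iff_eq_add']
          conv_lhs => rw [← hs' (x 0), Fin.sum_univ_succ]
        have h2 : x 0 = (↑c⁻¹ : D) • (c : D) • x 0 := by rw [smul_smul, Units.inv_mul, one_smul]
        rw [h2, h1]
        exact Submodule.smul_mem _ _ (Submodule.sum_mem _ fun i _ =>
          Submodule.smul_mem _ _ (Submodule.subset_span ⟨i, rfl⟩))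
      rw [← top_le_iff, ← hx, Submodule.span_le]
      rintro _ ⟨i, rfl⟩
      refine Fin.cases h0 (fun j => ?_) i
      exact Submodule.subset_span ⟨j, rfl⟩

/-- Finitely generated projective modules over a local ring are free. -/
theorem exists_basis_of_projective (V : Type v) [AddCommGroup V] [Module D V]
    [Module.Projective D V] [Module.Finite D V] : ∃ m, Nonempty (Module.Basis (Fin m) D V) := by
  obtain ⟨n, x, hx⟩ := Module.Finite.exists_fin (R := D) (M := V)
  exact exists_basis_of_span_eq_top n x hx

end LocalRing

/-! ### Endomorphism rings of indecomposable modules -/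

section Fitting

variable {A : Type u} [Ring A]

lemma eq_top_or_eq_top_of_isCompl_of_indecomposable {M : ModuleCat.{u} A} (hM : Indecomposable M)
    {N₁ N₂ : Submodule A M} (h : IsCompl N₁ N₂) : N₁ = ⊤ ∨ N₂ = ⊤ := by
  have key := hM.2 (ModuleCat.of A N₁) (ModuleCat.of A N₂)
    (((Submodule.prodEquivOfIsCompl N₁ N₂ h).symm.toModuleIso) ≪≫
      (ModuleCat.biprodIsoProd (ModuleCat.of A N₁) (ModuleCat.of A N₂)).symm)
  rcases key with h1 | h1
  · right
    have := ModuleCat.subsingleton_of_isZero h1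
    have h2 : N₁ = ⊥ := (Submodule.eq_bot_iff _).2 fun x hx =>
      congrArg Subtype.val (Subsingleton.elim (⟨x, hx⟩ : N₁) 0)
    exact eq_top_of_bot_isCompl (h2 ▸ h)
  · left
    have := ModuleCat.subsingleton_of_isZero h1
    have h2 : N₂ = ⊥ := (Submodule.eq_bot_iff _).2 fun x hx =>
      congrArg Subtype.val (Subsingleton.elim (⟨x, hx⟩ : N₂) 0)
    exact eq_top_of_isCompl_bot (h2 ▸ h)

/-- Fitting's lemma: M = ker fⁿ ⊕ im fⁿ for large n, so indecomposability makes f nilpotent or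
invertible. -/
theorem isLocalRing_end_of_indecomposable {M : ModuleCat.{u} A} (hM : Indecomposable M)
    [IsNoetherian A M] [IsArtinian A M] : IsLocalRing (Module.End A M) := by
  have : Nontrivial M := by
    by_contra h
    rw [not_nontrivial_iff_subsingleton] at h
    exact hM.1 (ModuleCat.isZero_of_subsingleton M)
  refine IsLocalRing.of_isUnit_or_isUnit_one_sub_self fun f => ?_
  obtain ⟨n, hn, hn1⟩ := (f.eventually_isCompl_ker_pow_range_pow.and
    (Filter.eventually_ge_atTop 1)).exists
  rcases eq_top_or_eq_top_of_isCompl_of_indecomposable hM hn with h | h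
  · right
    have : f ^ n = 0 := LinearMap.ker_eq_top.1 h
    exact (show IsNilpotent f from ⟨n, this⟩).isUnit_one_sub
  · left
    have h2 : LinearMap.ker (f ^ n) = ⊥ := eq_bot_of_isCompl_top (h ▸ hn)
    have h3 : IsUnit (f ^ n) := (Module.End.isUnit_iff _).2
      ⟨LinearMap.ker_eq_bot.1 h2, LinearMap.range_eq_top.1 h⟩
    exact (isUnit_pow_iff (by omega)).1 h3

end Fitting

/-! ### The associated algebra of a preadditive category -/

namespace AssocAlgebra

section Entries

variable {C : Type w} [Category.{v} C]

lemma ext {f g : AssocAlgebra C} (h : ∀ x y, f x y = g x y) : f = g :=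
  funext fun x => funext fun y => h x y

variable [Preadditive C]

@[simp] lemma zero_apply (x y : C) : (0 : AssocAlgebra C) x y = 0 := rfl
@[simp] lemma add_apply (f g : AssocAlgebra C) (x y : C) : (f + g) x y = f x y + g x y := rfl

/-- The entries of an element of the associated algebra. -/
def entry (x y : C) : AssocAlgebra C →+ (x ⟶ y) where
  toFun f := f x y
  map_zero' := rfl
  map_add' _ _ := rfl

lemma sum_apply {ι : Type*} (s : Finset ι) (f : ι → AssocAlgebra C) (x y : C) :
    (∑ i ∈ s, f i) x y = ∑ i ∈ s, f i x y :=
  map_sum (entry x y) f s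

end Entries

/-! ### Matrix units and the principal projective modules -/

section Single

variable {C : Type w} [Category.{v} C] [Preadditive C] [DecidableEq C]

/-- A morphism, as an element of the associated algebra. -/
def single {x y : C} (f : x ⟶ y) : AssocAlgebra C := fun a b =>
  if h : a = x ∧ y = b then eqToHom h.1 ≫ f ≫ eqToHom h.2 else 0

@[simp] lemma single_apply_self {x y : C} (f : x ⟶ y) : single f x y = f := by
  simp [single]

lemma single_apply_of_ne_left {x y : C} (f : x ⟶ y) {a : C} (h : a ≠ x) (b : C) :
    single f a b = 0 := by
  simp [single, h]

lemma single_apply_of_ne_right {x y : C} (f : x ⟶ y) (a : C) {b : C} (h : b ≠ y) :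
    single f a b = 0 := by
  simp [single, Ne.symm h]

lemma idem_eq_single (x : C) : idem x = single (𝟙 x) := by
  refine ext fun a b => ?_
  by_cases h : a = x ∧ x = b
  · obtain ⟨rfl, rfl⟩ := h
    simp [idem]
  · simp [idem, single, h]

lemma single_add {x y : C} (f g : x ⟶ y) : single (f + g) = single f + single g := by
  refine ext fun a b => ?_
  by_cases h : a = x ∧ y = b
  · obtain ⟨rfl, rfl⟩ := h
    simp
  · simp [single, h]

lemma single_zero (x y : C) : single (0 : x ⟶ y) = 0 := by
  refine ext fun a b => ?_
  by_cases h : a = x ∧ y = b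
  · obtain ⟨rfl, rfl⟩ := h
    simp
  · simp [single, h]

variable [Fintype C]

lemma mul_apply (f g : AssocAlgebra C) (x z : C) : (f * g) x z = ∑ y, g x y ≫ f y z := rfl

@[simp] lemma mul_single_apply {x y : C} (g : AssocAlgebra C) (f : x ⟶ y) (z : C) :
    (g * single f) x z = f ≫ g y z := by
  rw [mul_apply, Finset.sum_eq_single y]
  · simp
  · intro b _ hb
    rw [single_apply_of_ne_right f x hb, zero_comp]
  · simp

lemma mul_single_apply_of_ne {x y : C} (g : AssocAlgebra C) (f : x ⟶ y) {a : C} (h : a ≠ x)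
    (z : C) : (g * single f) a z = 0 := by
  rw [mul_apply]
  exact Finset.sum_eq_zero fun b _ => by rw [single_apply_of_ne_left f h, zero_comp]

@[simp] lemma single_mul_apply {x y : C} (f : x ⟶ y) (g : AssocAlgebra C) (a : C) :
    (single f * g) a y = g a x ≫ f := by
  rw [mul_apply, Finset.sum_eq_single x]
  · simp
  · intro b _ hb
    rw [single_apply_of_ne_left f hb, comp_zero]
  · simp

lemma single_mul_apply_of_ne {x y : C} (f : x ⟶ y) (g : AssocAlgebra C) (a : C) {z : C}
    (h : z ≠ y) : (single f * g) a z = 0 := by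
  rw [mul_apply]
  exact Finset.sum_eq_zero fun b _ => by rw [single_apply_of_ne_right f b h, comp_zero]

@[simp] lemma single_mul_single {x y z : C} (f : x ⟶ y) (g : y ⟶ z) :
    single g * single f = single (f ≫ g) := by
  refine ext fun a b => ?_
  by_cases ha : a = x
  · subst ha
    by_cases hb : b = z
    · subst hb
      simp
    · rw [single_mul_apply_of_ne _ _ _ hb, single_apply_of_ne_right _ _ hb]
  · rw [mul_single_apply_of_ne _ _ ha, single_apply_of_ne_left _ ha]

@[simp] lemma idem_mul_single {x y : C} (f : x ⟶ y) : idem y * single f = single f := by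
  rw [idem_eq_single, single_mul_single, Category.comp_id]

lemma idem_mul_apply_self (x : C) (g : AssocAlgebra C) (a : C) : (idem x * g) a x = g a x := by
  rw [idem_eq_single, single_mul_apply, Category.comp_id]

lemma idem_mul_apply_of_ne (x : C) (g : AssocAlgebra C) (a : C) {z : C} (h : z ≠ x) :
    (idem x * g) a z = 0 := by
  rw [idem_eq_single, single_mul_apply_of_ne _ _ _ h]

lemma idem_mul_mul_idem (x y : C) (g : AssocAlgebra C) :
    idem y * g * idem x = single (g x y) := by
  refine ext fun a b => ?_
  rw [mul_assoc, idem_eq_single x]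
  by_cases hb : b = y
  · subst hb
    rw [idem_mul_apply_self]
    by_cases ha : a = x
    · subst ha
      simp
    · rw [mul_single_apply_of_ne _ _ ha, single_apply_of_ne_left _ ha]
  · rw [idem_mul_apply_of_ne _ _ _ hb, single_apply_of_ne_right _ _ hb]

@[simp] lemma idem_mul_idem (x : C) : idem x * idem x = idem x := by
  rw [idem_eq_single, single_mul_single, Category.comp_id]

lemma sum_idem : ∑ x : C, idem x = 1 := by
  refine ext fun a b => ?_
  rw [sum_apply]
  change _ = if h : a = b then eqToHom h else 0
  rw [Finset.sum_eq_single a]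
  · simp [idem]
  · intro x _ hx
    simp [idem, Ne.symm hx]
  · simp

lemma exists_idem_smul_ne_zero {M : Type*} [AddCommGroup M] [Module (AssocAlgebra C) M] {m : M}
    (hm : m ≠ 0) : ∃ x : C, idem x • m ≠ 0 := by
  by_contra! h
  apply hm
  rw [← one_smul (AssocAlgebra C) m, ← sum_idem, Finset.sum_smul]
  exact Finset.sum_eq_zero fun x _ => h x

lemma mem_span_idem {x : C} {f : AssocAlgebra C} :
    f ∈ Submodule.span (AssocAlgebra C) {idem x} ↔ f * idem x = f := by
  rw [Submodule.mem_span_singleton]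
  constructor
  · rintro ⟨g, rfl⟩
    rw [smul_eq_mul, mul_assoc, idem_mul_idem]
  · intro h
    exact ⟨f, h⟩

lemma apply_eq_zero_of_mem_span_idem {x : C} {f : AssocAlgebra C}
    (hf : f ∈ Submodule.span (AssocAlgebra C) {idem x}) {a : C} (ha : a ≠ x) (b : C) :
    f a b = 0 := by
  rw [← mem_span_idem.1 hf, idem_eq_single, mul_single_apply_of_ne _ _ ha]

lemma single_mem_span_idem {x y : C} (f : x ⟶ y) :
    single f ∈ Submodule.span (AssocAlgebra C) {idem x} := by
  rw [mem_span_idem, idem_eq_single, single_mul_single, Category.id_comp]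

lemma proj_ext {x : C} {f g : proj x} (h : ∀ y, f.1 x y = g.1 x y) : f = g := by
  refine Subtype.ext (ext fun a b => ?_)
  by_cases ha : a = x
  · subst ha; exact h b
  · rw [apply_eq_zero_of_mem_span_idem f.2 ha, apply_eq_zero_of_mem_span_idem g.2 ha]

/-- The canonical generator of `proj x`. -/
def projGen (x : C) : proj x := ⟨idem x, Submodule.mem_span_singleton_self _⟩

@[simp] lemma projGen_val (x : C) : (projGen x).1 = idem x := rfl

lemma smul_projGen {x : C} (f : proj x) : f.1 • projGen x = f :=
  Subtype.ext (mem_span_idem.1 f.2)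

/-- The linear map from `proj x` determined by an element. -/
noncomputable def projLift (x : C) {M : Type*} [AddCommGroup M] [Module (AssocAlgebra C) M] (m : M) :
    proj x →ₗ[AssocAlgebra C] M :=
  LinearMap.toSpanSingleton (AssocAlgebra C) M m ∘ₗ
    (Submodule.span (AssocAlgebra C) {(idem x : AssocAlgebra C)}).subtype

lemma projLift_apply (x : C) {M : Type*} [AddCommGroup M] [Module (AssocAlgebra C) M] (m : M)
    (f : proj x) : projLift x m f = f.1 • m := rfl

/-- A direct summand of the regular module: right multiplication by the idempotent retracts onto it.
-/
lemma projective_proj (x : C) : Module.Projective (AssocAlgebra C) (proj x) :=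
  Module.Projective.of_split (R := AssocAlgebra C) (M := AssocAlgebra C)
    (Submodule.span (AssocAlgebra C) {(idem x : AssocAlgebra C)}).subtype
    (LinearMap.toSpanSingleton (AssocAlgebra C) (proj x) (projGen x))
    (LinearMap.ext fun f => smul_projGen f)

end Single

end AssocAlgebra

/-! ### Modules with a filtration -/

section Filtration

variable {R : Type u} [Ring R] {ι : Type w} {F : ι → ModuleCat.{v} R} {I : Set ι}

lemma HasFiltration.mono {J : Set ι} (hIJ : I ⊆ J) {M : Type v} [AddCommGroup M] [Module R M]
    (h : HasFiltration R F I M) : HasFiltration R F J M := by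
  obtain ⟨n, N, h0, h1, h2⟩ := h
  refine ⟨n, N, h0, h1, fun j => ⟨(h2 j).1, ?_⟩⟩
  obtain ⟨i, hi, e⟩ := (h2 j).2
  exact ⟨i, hIJ hi, e⟩

lemma hasFiltration_of_subsingleton (F : ι → ModuleCat.{v} R) (I : Set ι) (M : Type v)
    [AddCommGroup M] [Module R M] [Subsingleton M] : HasFiltration R F I M :=
  ⟨0, fun _ => ⊤, Subsingleton.elim _ _, rfl, fun j => j.elim0⟩

lemma HasFiltration.extend {M' M : Type v} [AddCommGroup M'] [Module R M'] [AddCommGroup M]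
    [Module R M] {i : ι} (hi : i ∈ I) (φ : M' →ₗ[R] M) (ψ : M →ₗ[R] F i)
    (hφ : Function.Injective φ) (hψ : Function.Surjective ψ)
    (hφψ : LinearMap.range φ = LinearMap.ker ψ) (h : HasFiltration R F I M') :
    HasFiltration R F I M := by
  obtain ⟨n, N, h0, h1, h2⟩ := h
  -- The image of the filtration of M', with the whole of M added on top as one new step.
  refine ⟨n + 1, Fin.snoc (α := fun _ => Submodule R M) (fun j => (N j).map φ) ⊤, ?_, ?_,
    fun j => ?_⟩
  · rw [← Fin.castSucc_zero, Fin.snoc_castSucc, h0, Submodule.map_bot]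
  · rw [Fin.snoc_last]
  · refine Fin.lastCases ?_ (fun j => ?_) j
    · rw [Fin.succ_last, Fin.snoc_last, Fin.snoc_castSucc, h1, Submodule.map_top, hφψ]
      refine ⟨le_top, i, hi, ⟨?_⟩⟩
      refine (Submodule.Quotient.equiv _ _ Submodule.topEquiv ?_).trans
        (ψ.quotKerEquivOfSurjective hψ)
      ext x
      simp [Submodule.submoduleOf]
    · rw [← Fin.castSucc_succ, Fin.snoc_castSucc, Fin.snoc_castSucc]
      obtain ⟨hle, i', hi', ⟨e⟩⟩ := h2 j
      refine ⟨Submodule.map_mono hle, i', hi', ⟨?_⟩⟩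
      refine (Submodule.Quotient.equiv _ _
        (Submodule.equivMapOfInjective φ hφ (N j.succ)) ?_).symm.trans e
      ext ⟨x, hx⟩
      constructor
      · rintro ⟨y, hy, hyx⟩
        rw [← hyx]
        exact ⟨y.1, hy, rfl⟩
      · rintro ⟨y, hy, hyx⟩
        exact ⟨⟨y, hle hy⟩, hy, Subtype.ext hyx⟩

theorem HasFiltration.induction {P : ∀ (M : Type v) [AddCommGroup M] [Module R M], Prop}
    (zero : ∀ (M : Type v) [AddCommGroup M] [Module R M], Subsingleton M → P M)
    (extend : ∀ (M' M : Type v) [AddCommGroup M'] [Module R M'] [AddCommGroup M] [Module R M]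
      (i : ι) (φ : M' →ₗ[R] M) (ψ : M →ₗ[R] F i), i ∈ I → Function.Injective φ →
      Function.Surjective ψ → LinearMap.range φ = LinearMap.ker ψ → P M' → P M)
    {M : Type v} [AddCommGroup M] [Module R M] (h : HasFiltration R F I M) : P M := by
  obtain ⟨n, N, h0, h1, h2⟩ := h
  -- Quantifying over all modules isomorphic to `N j` spares an assumption that `P` is invariant
  -- under isomorphism.
  have key : ∀ j : Fin (n + 1), ∀ (M' : Type v) [AddCommGroup M'] [Module R M'],
      (M' ≃ₗ[R] N j) → P M' := by
    intro j
    induction j using Fin.induction with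
    | zero =>
      intro M' _ _ e
      have : Subsingleton (N 0) := by rw [h0]; infer_instance
      exact zero M' e.toEquiv.subsingleton
    | succ j ih =>
      intro M' _ _ e
      obtain ⟨hle, i, hi, ⟨f⟩⟩ := h2 j
      refine extend (N j.castSucc) M' i (e.symm.toLinearMap ∘ₗ Submodule.inclusion hle)
        (f.toLinearMap ∘ₗ Submodule.mkQ _ ∘ₗ e.toLinearMap) hi
        (e.symm.injective.comp (Submodule.inclusion_injective hle))
        (f.surjective.comp ((Submodule.mkQ_surjective _).comp e.surjective)) ?_
        (ih _ (LinearEquiv.refl _ _))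
      ext x
      have hker : x ∈ LinearMap.ker (f.toLinearMap ∘ₗ
          ((N j.castSucc).submoduleOf (N j.succ)).mkQ ∘ₗ e.toLinearMap) ↔
          (e x).1 ∈ N j.castSucc := by
        rw [LinearMap.mem_ker, LinearMap.comp_apply]
        exact (f.map_eq_zero_iff).trans (Submodule.Quotient.mk_eq_zero _)
      rw [hker]
      constructor
      · rintro ⟨y, rfl⟩
        simp
      · intro hx'
        exact ⟨⟨_, hx'⟩, e.injective (by simp; rfl)⟩
  exact key (Fin.last n) M (by rw [h1]; exact Submodule.topEquiv.symm)

end Filtration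

namespace AssocAlgebra

/-! ### Projective modules over the associated algebra of a directed category -/

section Directed

variable {C : Type w} [Category.{v} C] [Preadditive C] [Fintype C] [DecidableEq C]
  [PartialOrder C]

/-- A composite x → y → x with y ≠ x vanishes, as one of its factors goes against the order. -/
lemma mul_apply_self (hC : IsDirectedCategory C (· ≤ ·)) (g f : AssocAlgebra C) (x : C) :
    (g * f) x x = f x x ≫ g x x := by
  rw [mul_apply, Finset.sum_eq_single x]
  · intro y _ hy
    by_cases h : x ≤ y
    · rw [hC y x (fun h' => hy (le_antisymm h' h)) (g y x), comp_zero]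
    · rw [hC x y h (f x y), zero_comp]
  · simp

/-- The elements of `proj x` whose entry at `x` is not invertible. -/
def projRad (hC : IsDirectedCategory C (· ≤ ·)) (hloc : ∀ x : C, IsLocalRing (End x)) (x : C) :
    Submodule (AssocAlgebra C) (proj x) where
  carrier := {f | ¬ IsUnit (show End x from f.1 x x)}
  zero_mem' := by
    have := hloc x
    exact not_isUnit_zero (M₀ := End x)
  add_mem' {f g} hf hg := by
    have := hloc x
    exact IsLocalRing.nonunits_add (R := End x) hf hg
  smul_mem' g f hf := by
    have := hloc x
    intro h
    apply hf
    have h1 : (g • f).1 x x = (show End x from g x x) * (show End x from f.1 x x) :=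
      mul_apply_self hC g f.1 x
    rw [h1] at h
    exact isUnit_right_of_isUnit_mul (D := End x) h

lemma mem_projRad {hC : IsDirectedCategory C (· ≤ ·)} {hloc : ∀ x : C, IsLocalRing (End x)}
    {x : C} {f : proj x} : f ∈ projRad hC hloc x ↔ ¬ IsUnit (show End x from f.1 x x) := Iff.rfl

-- Cutting f down by e_x leaves only its entry at x; inverting that entry recovers the generator
-- e_x.
omit [PartialOrder C] in
lemma eq_top_of_isUnit_mem {x : C} {N : Submodule (AssocAlgebra C) (proj x)} {f : proj x}
    (hf : f ∈ N) (hu : IsUnit (show End x from f.1 x x)) : N = ⊤ := by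
  obtain ⟨u, hu⟩ := hu
  have h1 : projGen x ∈ N := by
    have h2 : (single (show x ⟶ x from (↑u⁻¹ : End x)) : AssocAlgebra C) • f.1 • projGen x
        = projGen x := by
      refine Subtype.ext ?_
      have h3 : f.1 x x ≫ (show x ⟶ x from (↑u⁻¹ : End x)) = 𝟙 x := by
        have := u.inv_mul
        rw [hu] at this
        exact this
      change single _ * (f.1 * idem x) = idem x
      have h4 : (single (show x ⟶ x from (↑u⁻¹ : End x)) : AssocAlgebra C)
          = single (show x ⟶ x from (↑u⁻¹ : End x)) * idem x := by
        rw [idem_eq_single, single_mul_single, Category.id_comp]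
      rw [h4, mul_assoc, ← mul_assoc (idem x), idem_mul_mul_idem, single_mul_single, h3,
        idem_eq_single]
    rw [← h2, smul_projGen]
    exact N.smul_mem _ hf
  rw [eq_top_iff]
  rintro g -
  rw [← smul_projGen g]
  exact N.smul_mem _ h1

variable (hC : IsDirectedCategory C (· ≤ ·)) (hloc : ∀ x : C, IsLocalRing (End x))

include hC hloc

lemma isCoatom_projRad (x : C) : IsCoatom (projRad hC hloc x) := by
  refine ⟨fun h => ?_, fun N hN => ?_⟩
  · have h1 : projGen x ∈ projRad hC hloc x := h ▸ Submodule.mem_top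
    refine mem_projRad.1 h1 ?_
    rw [projGen_val, idem_eq_single, single_apply_self]
    exact isUnit_one (M := End x)
  · obtain ⟨f, hf, hf'⟩ := Set.exists_of_ssubset hN
    exact eq_top_of_isUnit_mem hf (not_not.1 hf')

/-- Together with `isCoatom_projRad` this makes `projRad` the unique maximal submodule, which gives
both the projective cover and the classification of simple modules. -/
lemma le_projRad_of_ne_top {x : C} {N : Submodule (AssocAlgebra C) (proj x)} (hN : N ≠ ⊤) :
    N ≤ projRad hC hloc x := fun _ hf hu => hN (eq_top_of_isUnit_mem hf hu)

/-- The simple quotient of `proj x`. -/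
def projTop (x : C) : ModuleCat.{max w v} (AssocAlgebra C) :=
  ModuleCat.of _ (proj x ⧸ projRad hC hloc x)

/-- The projection onto the simple quotient of `proj x`. -/
def projTopMk (x : C) : proj x →ₗ[AssocAlgebra C] projTop hC hloc x :=
  (projRad hC hloc x).mkQ

lemma projTopMk_surjective (x : C) : Function.Surjective (projTopMk hC hloc x) :=
  Submodule.mkQ_surjective _

lemma ker_projTopMk (x : C) : LinearMap.ker (projTopMk hC hloc x) = projRad hC hloc x :=
  Submodule.ker_mkQ _

lemma isSimpleModule_projTop (x : C) : IsSimpleModule (AssocAlgebra C) (projTop hC hloc x) :=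
  isSimpleModule_iff_isCoatom.2 (isCoatom_projRad hC hloc x)

lemma isProjectiveCover_projTop (x : C) :
    IsProjectiveCover (projTopMk hC hloc x) where
  projective := projective_proj x
  surjective := projTopMk_surjective hC hloc x
  superfluous N hN := by
    by_contra h
    rw [ker_projTopMk, sup_eq_right.2 (le_projRad_of_ne_top hC hloc h)] at hN
    exact (isCoatom_projRad hC hloc x).1 hN

lemma idem_smul_projTop_of_ne {x y : C} (h : y ≠ x) (s : projTop hC hloc x) :
    (idem y : AssocAlgebra C) • s = 0 := by
  obtain ⟨f, rfl⟩ := projTopMk_surjective hC hloc x s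
  rw [← map_smul, ← LinearMap.mem_ker, ker_projTopMk, mem_projRad]
  have : ((idem y : AssocAlgebra C) • f).1 x x = 0 := idem_mul_apply_of_ne y f.1 x (Ne.symm h)
  rw [this]
  have := hloc x
  exact not_isUnit_zero (M₀ := End x)

lemma exists_idem_smul_projTop_ne_zero (x : C) :
    ∃ s : projTop hC hloc x, (idem x : AssocAlgebra C) • s ≠ 0 := by
  have := isSimpleModule_projTop hC hloc x
  have := IsSimpleModule.nontrivial (AssocAlgebra C) (projTop hC hloc x)
  obtain ⟨s, hs⟩ := exists_ne (0 : projTop hC hloc x)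
  obtain ⟨y, hy⟩ := exists_idem_smul_ne_zero (C := C) hs
  by_cases h : y = x
  · exact ⟨s, h ▸ hy⟩
  · exact absurd (idem_smul_projTop_of_ne hC hloc h s) hy

lemma eq_of_projTop_equiv {x y : C}
    (e : projTop hC hloc x ≃ₗ[AssocAlgebra C] projTop hC hloc y) : x = y := by
  by_contra h
  obtain ⟨s, hs⟩ := exists_idem_smul_projTop_ne_zero hC hloc x
  apply hs
  apply e.injective
  rw [map_smul, idem_smul_projTop_of_ne hC hloc h, map_zero]

/-- Some e_x acts nontrivially on T, giving a nonzero, hence surjective, map P_x → T; its kernel is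
maximal, so it is `projRad`. -/
lemma exists_equiv_projTop (T : Type*) [AddCommGroup T] [Module (AssocAlgebra C) T]
    [IsSimpleModule (AssocAlgebra C) T] :
    ∃ x : C, Nonempty (T ≃ₗ[AssocAlgebra C] projTop hC hloc x) := by
  have := IsSimpleModule.nontrivial (AssocAlgebra C) T
  obtain ⟨t, ht⟩ := exists_ne (0 : T)
  obtain ⟨x, hx⟩ := exists_idem_smul_ne_zero (C := C) ht
  refine ⟨x, ?_⟩
  have h0 : projLift x t ≠ 0 := fun h => hx (by
    have := LinearMap.congr_fun h (projGen x)
    rwa [projLift_apply, projGen_val] at this)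
  have hs : Function.Surjective (projLift x t) :=
    LinearMap.range_eq_top.1 ((eq_bot_or_eq_top _).resolve_left
      (fun h => h0 (LinearMap.range_eq_bot.1 h)))
  have hk : LinearMap.ker (projLift x t) = projRad hC hloc x := by
    have h1 : LinearMap.ker (projLift x t) ≤ projRad hC hloc x :=
      le_projRad_of_ne_top hC hloc (fun h => h0 (LinearMap.ker_eq_top.1 h))
    have h2 : IsCoatom (LinearMap.ker (projLift x t)) :=
      isSimpleModule_iff_isCoatom.1 (IsSimpleModule.congr
        ((projLift x t).quotKerEquivOfSurjective hs))
    exact ((h2.le_iff_eq (isCoatom_projRad hC hloc x).1).1 h1).symm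
  exact ⟨((projLift x t).quotKerEquivOfSurjective hs).symm.trans (Submodule.quotEquivOfEq _ _ hk)⟩

lemma exists_idem_smul_ne_zero_of_isCompositionFactor {M : Type max w v} [AddCommGroup M]
    [Module (AssocAlgebra C) M] {x : C}
    (h : IsCompositionFactor (AssocAlgebra C) M (projTop hC hloc x)) :
    ∃ m : M, (idem x : AssocAlgebra C) • m ≠ 0 := by
  obtain ⟨N₁, N₂, -, ⟨e⟩⟩ := h
  obtain ⟨s, hs⟩ := exists_idem_smul_projTop_ne_zero hC hloc x
  obtain ⟨m, hm⟩ := Submodule.mkQ_surjective _ (e.symm s)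
  refine ⟨m.1, fun h0 => hs ?_⟩
  have h1 : (idem x : AssocAlgebra C) • m = 0 := Subtype.ext h0
  rw [← e.apply_symm_apply s, ← hm, ← map_smul, ← map_smul, h1, map_zero, map_zero]

omit hC hloc [PartialOrder C] in
lemma finite_of_finite_hom (k : Type u) [Field k] [Linear k C]
    (hfin : ∀ x y : C, Module.Finite k (x ⟶ y)) : Module.Finite k (AssocAlgebra C) :=
  inferInstanceAs (Module.Finite k (∀ x y : C, x ⟶ y))

/-- To see that a directed category is standardly stratified it suffices to give the standard
modules. -/
lemma isStandardlyStratifiedCategory_of_standard (k : Type u) [Field k] [Linear k C]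
    (hfin : ∀ x y : C, Module.Finite k (x ⟶ y)) (r : C → C → Prop) [IsPartialOrder C r]
    (Δ : C → ModuleCat.{max w v} (AssocAlgebra C))
    (h1 : ∀ (i j : C) (m : Δ i), ¬ r j i → (idem j : AssocAlgebra C) • m = 0)
    (h2 : ∀ i, ∃ q : proj i →ₗ[AssocAlgebra C] Δ i, Function.Surjective q ∧
      HasFiltration (AssocAlgebra C) Δ {j | r i j ∧ i ≠ j} (LinearMap.ker q)) :
    IsStandardlyStratifiedCategory k C r where
  finite := finite_of_finite_hom k hfin
  exists_standard := by
    refine ⟨projTop hC hloc, Δ, isSimpleModule_projTop hC hloc,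
      fun i j ⟨e⟩ => eq_of_projTop_equiv hC hloc e, fun T hT => exists_equiv_projTop hC hloc T,
      fun i => ⟨_, isProjectiveCover_projTop hC hloc i⟩, fun i j hij hc => ?_, h2⟩
    obtain ⟨m, hm⟩ := exists_idem_smul_ne_zero_of_isCompositionFactor hC hloc hc
    exact hm (h1 i j m hij)

omit hloc in
lemma idem_smul_proj_eq_zero {x y : C} (h : ¬ x ≤ y) (f : proj x) :
    (idem y : AssocAlgebra C) • f = 0 := by
  refine proj_ext fun z => ?_
  change (idem y * f.1) x z = 0
  by_cases hz : z = y
  · subst hz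
    rw [idem_mul_apply_self]
    exact hC _ _ h _
  · rw [idem_mul_apply_of_ne _ _ _ hz]

/-- A directed category is standardly stratified for the opposite order. -/
theorem isStandardlyStratifiedCategory_ge (k : Type u) [Field k] [Linear k C]
    (hfin : ∀ x y : C, Module.Finite k (x ⟶ y)) :
    IsStandardlyStratifiedCategory k C (· ≥ ·) := by
  -- The standard modules are the projectives themselves: directedness bounds their composition
  -- factors, and the kernels are zero.
  refine isStandardlyStratifiedCategory_of_standard hC hloc k hfin _ proj
    (fun i j m hij => idem_smul_proj_eq_zero hC hij m)
    fun i => ⟨LinearMap.id, Function.surjective_id, ?_⟩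
  rw [LinearMap.ker_id]
  exact hasFiltration_of_subsingleton _ _ _

end Directed

/-! ### Standard modules for the given order, when the morphism groups are projective -/

section Standard

variable {C : Type w} [Category.{v} C] [Preadditive C] [Fintype C] [DecidableEq C]
  [PartialOrder C] (hC : IsDirectedCategory C (· ≤ ·))

/-- The elements of `proj x` whose entry at `x` vanishes. -/
def stdKer (x : C) : Submodule (AssocAlgebra C) (proj x) where
  carrier := {f | f.1 x x = 0}
  zero_mem' := rfl
  add_mem' {f g} hf hg := by
    change f.1 x x + g.1 x x = 0
    rw [show f.1 x x = 0 from hf, show g.1 x x = 0 from hg, add_zero]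
  smul_mem' g f hf := by
    change (g * f.1) x x = 0
    rw [mul_apply_self hC, show f.1 x x = 0 from hf, zero_comp]

/-- The quotient `C(x, x)` of `proj x`. -/
def std (x : C) : ModuleCat.{max w v} (AssocAlgebra C) :=
  ModuleCat.of _ (proj x ⧸ stdKer hC x)

/-- The projection of `proj x` onto its standard quotient. -/
def stdMk (x : C) : proj x →ₗ[AssocAlgebra C] std hC x := (stdKer hC x).mkQ

lemma stdMk_surjective (x : C) : Function.Surjective (stdMk hC x) :=
  Submodule.mkQ_surjective _

lemma ker_stdMk (x : C) : LinearMap.ker (stdMk hC x) = stdKer hC x := Submodule.ker_mkQ _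

lemma stdMk_eq_zero {x : C} {f : proj x} : stdMk hC x f = 0 ↔ f.1 x x = 0 := by
  rw [← LinearMap.mem_ker, ker_stdMk]
  rfl

lemma stdMk_eq {x : C} {f g : proj x} (h : f.1 x x = g.1 x x) : stdMk hC x f = stdMk hC x g := by
  rw [← sub_eq_zero, ← map_sub, stdMk_eq_zero]
  exact sub_eq_zero.2 h

lemma idem_smul_std_of_ne {x y : C} (h : y ≠ x) (m : std hC x) :
    (idem y : AssocAlgebra C) • m = 0 := by
  obtain ⟨f, rfl⟩ := stdMk_surjective hC x m
  rw [← map_smul, stdMk_eq_zero]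
  exact idem_mul_apply_of_ne y f.1 x (Ne.symm h)

/-- An endomorphism of `x`, as an element of `proj x`. -/
def projOfEnd (x : C) (d : End x) : proj x := ⟨single (show x ⟶ x from d), single_mem_span_idem _⟩

omit [PartialOrder C] in
@[simp] lemma projOfEnd_apply (x : C) (d : End x) : (projOfEnd x d).1 x x = d :=
  single_apply_self _

variable {x : C} {n : C → ℕ} (b : ∀ y, Module.Basis (Fin (n y)) (End y) (x ⟶ y))

/-- The coordinates of an element of `proj x`. -/
noncomputable def coord (p : Σ y, Fin (n y)) (f : proj x) : End p.1 := (b p.1).repr (f.1 x p.1) p.2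

omit [PartialOrder C] in
lemma coord_add (p : Σ y, Fin (n y)) (f g : proj x) :
    coord b p (f + g) = coord b p f + coord b p g := by
  change (b p.1).repr (f.1 x p.1 + g.1 x p.1) p.2 = _
  rw [map_add, Finsupp.add_apply]
  rfl

omit [PartialOrder C] in
variable {b} in
lemma apply_eq_zero_of_coord {y : C} {f : proj x} (h : ∀ a, coord b ⟨y, a⟩ f = 0) :
    f.1 x y = 0 := by
  refine (b y).ext_elem fun a => ?_
  rw [map_zero, Finsupp.zero_apply]
  exact h a

-- In the entry of gf at the object of p, terms through a strictly smaller object vanish by `hf` and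
-- terms through an object not below it by directedness, leaving only the diagonal entry of g.
include hC in
lemma coord_smul {p : Σ y, Fin (n y)} {f : proj x} (hf : ∀ z < p.1, f.1 x z = 0)
    (g : AssocAlgebra C) :
    coord b p (g • f) = (show End p.1 from g p.1 p.1) * coord b p f := by
  have h : (g * f.1) x p.1 = (show End p.1 from g p.1 p.1) • f.1 x p.1 := by
    rw [mul_apply, Finset.sum_eq_single p.1]
    · rfl
    · intro z _ hz
      by_cases hzp : z ≤ p.1
      · rw [hf z (lt_of_le_of_ne hzp hz), zero_comp]
      · rw [hC _ _ hzp (g z p.1), comp_zero]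
    · simp
  change (b p.1).repr ((g * f.1) x p.1) p.2 = _
  rw [h, map_smul, Finsupp.smul_apply]
  rfl

/-- The elements of `proj x` whose coordinates outside of `T` vanish. -/
def coordSub (T : Finset (Σ y, Fin (n y)))
    (hT : ∀ p ∈ T, ∀ q : Σ y, Fin (n y), p.1 < q.1 → q ∈ T) :
    Submodule (AssocAlgebra C) (proj x) where
  carrier := {f | ∀ p ∉ T, coord b p f = 0}
  zero_mem' p _ := by
    change (b p.1).repr 0 p.2 = 0
    simp
  add_mem' {f g} hf hg p hp := by rw [coord_add, hf p hp, hg p hp, add_zero]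
  smul_mem' g f hf p hp := by
    -- As `T` is closed upwards, p ∉ T forces all indices over smaller objects out of `T`, so f
    -- vanishes there.
    rw [coord_smul hC b (fun z hz => apply_eq_zero_of_coord fun a =>
      hf ⟨z, a⟩ fun h => hp (hT _ h p hz)), hf p hp, mul_zero]

variable {hC b} in
lemma mem_coordSub {T : Finset (Σ y, Fin (n y))}
    {hT : ∀ p ∈ T, ∀ q : Σ y, Fin (n y), p.1 < q.1 → q ∈ T} {f : proj x} :
    f ∈ coordSub hC b T hT ↔ ∀ p ∉ T, coord b p f = 0 := Iff.rfl

/-- The coordinate at a minimal element of `T`. -/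
noncomputable def coordMap (T : Finset (Σ y, Fin (n y)))
    (hT : ∀ p ∈ T, ∀ q : Σ y, Fin (n y), p.1 < q.1 → q ∈ T) (p : Σ y, Fin (n y))
    (hp : ∀ q ∈ T, ¬ q.1 < p.1) : coordSub hC b T hT →ₗ[AssocAlgebra C] std hC p.1 where
  toFun f := stdMk hC p.1 (projOfEnd p.1 (coord b p f.1))
  map_add' f g := by
    refine (stdMk_eq hC ?_).trans (map_add (stdMk hC p.1) _ _)
    refine Eq.trans ?_ (congrArg₂ _ (projOfEnd_apply _ _) (projOfEnd_apply _ _)).symm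
    rw [projOfEnd_apply]
    exact coord_add b p f.1 g.1
  map_smul' g f := by
    refine (stdMk_eq hC ?_).trans (map_smul (stdMk hC p.1) g _)
    have h := coord_smul hC b (p := p) (f := f.1) (fun z hz => apply_eq_zero_of_coord fun a =>
      mem_coordSub.1 f.2 ⟨z, a⟩ fun h => hp _ h hz) g
    refine Eq.trans ?_ (mul_apply_self hC g _ _).symm
    rw [projOfEnd_apply, projOfEnd_apply]
    exact h

lemma coordMap_surjective (T : Finset (Σ y, Fin (n y)))
    (hT : ∀ p ∈ T, ∀ q : Σ y, Fin (n y), p.1 < q.1 → q ∈ T) (p : Σ y, Fin (n y))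
    (hp : ∀ q ∈ T, ¬ q.1 < p.1) (hpT : p ∈ T) :
    Function.Surjective (coordMap hC b T hT p hp) := by
  intro m
  obtain ⟨h, rfl⟩ := stdMk_surjective hC p.1 m
  -- The preimage is a multiple of the basis vector indexed by p, so all its other coordinates
  -- vanish.
  let e : x ⟶ p.1 := (show End p.1 from h.1 p.1 p.1) • b p.1 p.2
  have he : (b p.1).repr e = Finsupp.single p.2 (show End p.1 from h.1 p.1 p.1) := by
    rw [map_smul, Module.Basis.repr_self, Finsupp.smul_single, smul_eq_mul, mul_one]
  have hep : coord b p ⟨single e, single_mem_span_idem e⟩ = h.1 p.1 p.1 := by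
    change (b p.1).repr (single e x p.1) p.2 = _
    rw [single_apply_self, he, Finsupp.single_eq_same]
  refine ⟨⟨⟨single e, single_mem_span_idem e⟩, mem_coordSub.2 ?_⟩, stdMk_eq hC ?_⟩
  · rintro ⟨y, a⟩ hq
    change (b y).repr (single e x y) a = 0
    by_cases hy : y = p.1
    · subst hy
      have hne : a ≠ p.2 := fun h => hq (h ▸ hpT)
      rw [single_apply_self, he, Finsupp.single_apply, if_neg hne.symm]
    · rw [single_apply_of_ne_right _ _ hy, map_zero, Finsupp.zero_apply]
  · rw [projOfEnd_apply, hep]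

/-- Induction on the size of T: for p over a minimal object, the coordinate at p maps onto the
standard module of that object, with kernel the submodule for T without p. -/
lemma hasFiltration_coordSub (I : Set C) (N : ℕ) : ∀ (T : Finset (Σ y, Fin (n y)))
    (hT : ∀ p ∈ T, ∀ q : Σ y, Fin (n y), p.1 < q.1 → q ∈ T), T.card = N → (∀ p ∈ T, p.1 ∈ I) →
    HasFiltration (AssocAlgebra C) (std hC) I (coordSub hC b T hT) := by
  induction N with
  | zero =>
    intro T hT hN _
    obtain rfl := Finset.card_eq_zero.1 hN
    have : Subsingleton (coordSub hC b ∅ hT) := by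
      refine subsingleton_of_forall_eq 0 fun f => Subtype.ext (proj_ext fun y => ?_)
      exact apply_eq_zero_of_coord fun a => mem_coordSub.1 f.2 ⟨y, a⟩ (Finset.notMem_empty _)
    exact hasFiltration_of_subsingleton _ _ _
  | succ N ih =>
    intro T hT hN hI
    have hne : T.Nonempty := Finset.card_pos.1 (by omega)
    obtain ⟨p, hpT, hp⟩ : ∃ p ∈ T, ∀ q ∈ T, ¬ q.1 < p.1 := by
      -- Minimality concerns objects only; several indices of `T` may lie over the same minimal
      -- object.
      obtain ⟨y, hy⟩ := (T.image Sigma.fst).exists_minimal (hne.image _)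
      obtain ⟨p, hpT, rfl⟩ := Finset.mem_image.1 hy.1
      exact ⟨p, hpT, fun q hq => hy.not_lt (Finset.mem_image_of_mem _ hq)⟩
    have hT' : ∀ q ∈ T.erase p, ∀ r : Σ y, Fin (n y), q.1 < r.1 → r ∈ T.erase p := by
      intro q hq r hqr
      refine Finset.mem_erase.2 ⟨?_, hT q (Finset.mem_of_mem_erase hq) r hqr⟩
      rintro rfl
      exact hp q (Finset.mem_of_mem_erase hq) hqr
    have hle : coordSub hC b (T.erase p) hT' ≤ coordSub hC b T hT := fun f hf q hq =>
      mem_coordSub.1 hf q fun h => hq (Finset.mem_of_mem_erase h)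
    refine HasFiltration.extend (hI p hpT) (Submodule.inclusion hle) (coordMap hC b T hT p hp)
      (Submodule.inclusion_injective hle) (coordMap_surjective hC b T hT p hp hpT) ?_
      (ih _ hT' (by rw [Finset.card_erase_of_mem hpT, hN]; rfl)
        fun q hq => hI q (Finset.mem_of_mem_erase hq))
    ext f
    have hker : f ∈ LinearMap.ker (coordMap hC b T hT p hp) ↔
        coord b p f.1 = 0 := by
      rw [LinearMap.mem_ker]
      refine (stdMk_eq_zero hC).trans ?_
      rw [projOfEnd_apply]
    rw [hker, Submodule.range_inclusion]
    constructor
    · intro hf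
      exact (mem_coordSub (hC := hC) (hT := hT')).1 hf p (Finset.notMem_erase p T)
    · intro hf
      refine (mem_coordSub (hC := hC) (hT := hT')).2 fun q hq => ?_
      by_cases hqp : q = p
      · rw [hqp]; exact hf
      · exact mem_coordSub.1 f.2 q fun h => hq (Finset.mem_erase.2 ⟨hqp, h⟩)

-- Take T to be all indices over objects strictly above x: directedness kills the entries at objects
-- not above x, so only the entry at x remains as a condition.
include b in
lemma hasFiltration_stdKer : HasFiltration (AssocAlgebra C) (std hC) {y | x ≤ y ∧ x ≠ y}
    (stdKer hC x) := by
  classical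
  let T : Finset (Σ y, Fin (n y)) := Finset.univ.filter fun p => x < p.1
  have hT : ∀ p ∈ T, ∀ q : Σ y, Fin (n y), p.1 < q.1 → q ∈ T := fun p hp q hpq =>
    Finset.mem_filter.2 ⟨Finset.mem_univ _, (Finset.mem_filter.1 hp).2.trans hpq⟩
  have h := hasFiltration_coordSub hC b {y | x ≤ y ∧ x ≠ y} _ T hT rfl fun p hp =>
    lt_iff_le_and_ne.1 (Finset.mem_filter.1 hp).2
  have heq : coordSub hC b T hT = stdKer hC x := by
    ext f
    constructor
    · intro hf
      exact apply_eq_zero_of_coord fun a =>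
        mem_coordSub.1 hf ⟨x, a⟩ fun h => lt_irrefl _ (Finset.mem_filter.1 h).2
    · intro hf
      refine mem_coordSub.2 fun p hp => ?_
      have : f.1 x p.1 = 0 := by
        by_cases hxp : x ≤ p.1
        · rcases hxp.lt_or_eq with h | h
          · exact absurd (Finset.mem_filter.2 ⟨Finset.mem_univ p, h⟩) hp
          · rw [← h]; exact hf
        · exact hC _ _ hxp _
      change (b p.1).repr (f.1 x p.1) p.2 = 0
      rw [this, map_zero, Finsupp.zero_apply]
  rwa [heq] at h

end Standard

/-- A directed category, all of whose morphism groups are projective over the endomorphism rings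
of their targets, is standardly stratified. -/
theorem isStandardlyStratifiedCategory_le_of_projective {C : Type w} [Category.{v} C]
    [Preadditive C] [Fintype C] [DecidableEq C] [PartialOrder C]
    (hC : IsDirectedCategory C (· ≤ ·)) (hloc : ∀ x : C, IsLocalRing (End x)) (k : Type u)
    [Field k] [Linear k C] (hfin : ∀ x y : C, Module.Finite k (x ⟶ y))
    (hproj : ∀ x y : C, Module.Projective (End y) (x ⟶ y)) :
    IsStandardlyStratifiedCategory k C (· ≤ ·) := by
  have hbasis : ∀ x y : C, ∃ m, Nonempty (Module.Basis (Fin m) (End y) (x ⟶ y)) := by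
    intro x y
    have := hloc y
    have := hproj x y
    have := hfin x y
    -- Bilinearity of composition turns finiteness over k into finiteness over `End y`, which
    -- freeness over a local ring requires.
    have : IsScalarTower k (End y) (x ⟶ y) := ⟨fun a f g => Linear.comp_smul _ _ _ g a f⟩
    have : Module.Finite (End y) (x ⟶ y) := Module.Finite.of_restrictScalars_finite k _ _
    exact exists_basis_of_projective (D := End y) (x ⟶ y)
  choose n b using hbasis
  refine isStandardlyStratifiedCategory_of_standard hC hloc k hfin _ (std hC)
    (fun i j m hij => idem_smul_std_of_ne hC (fun h => hij h.le) m)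
    fun i => ⟨stdMk hC i, stdMk_surjective hC i, ?_⟩
  rw [ker_stdMk]
  exact hasFiltration_stdKer hC fun y => (b i y).some

end AssocAlgebra

/-- The sequence splits since M'' is projective, so M ≅ M' × M''. -/
theorem projective_of_exact {R M' M M'' : Type*} [Ring R] [AddCommGroup M'] [AddCommGroup M]
    [AddCommGroup M''] [Module R M'] [Module R M] [Module R M''] (φ : M' →ₗ[R] M)
    (ψ : M →ₗ[R] M'') (hφ : Function.Injective φ) (hψ : Function.Surjective ψ)
    (h : LinearMap.range φ = LinearMap.ker ψ) [Module.Projective R M'] [Module.Projective R M''] :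
    Module.Projective R M := by
  obtain ⟨s, hs⟩ := Module.projective_lifting_property ψ LinearMap.id hψ
  have hs' : ∀ z, ψ (s z) = z := fun z => LinearMap.congr_fun hs z
  have hφψ : ∀ x, ψ (φ x) = 0 := fun x => by
    rw [← LinearMap.mem_ker, ← h]; exact ⟨x, rfl⟩
  refine Module.Projective.of_equiv (LinearEquiv.ofBijective (φ.coprod s) ⟨?_, fun y => ?_⟩)
  · rw [← LinearMap.ker_eq_bot, LinearMap.ker_eq_bot']
    rintro ⟨x, z⟩ hxz
    rw [LinearMap.coprod_apply] at hxz
    have hz : z = 0 := by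
      have := congrArg ψ hxz
      rwa [map_add, hφψ, hs', zero_add, map_zero] at this
    subst hz
    rw [map_zero, add_zero] at hxz
    obtain rfl : x = 0 := hφ (hxz.trans (map_zero φ).symm)
    rfl
  · have : y - s (ψ y) ∈ LinearMap.range φ := by
      rw [h, LinearMap.mem_ker, map_sub, hs', sub_self]
    obtain ⟨x, hx⟩ := this
    exact ⟨(x, ψ y), by rw [LinearMap.coprod_apply, hx, sub_add_cancel]⟩

namespace AssocAlgebra

/-! ### The part of a module at an object -/

section Corner

variable {C : Type w} [Category.{v} C] [Preadditive C] [Fintype C] [DecidableEq C] (y : C)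

/-- The elements of `M` fixed by the idempotent of `y`. -/
def corner (M : Type*) [AddCommGroup M] [Module (AssocAlgebra C) M] : AddSubgroup M where
  carrier := {m | (idem y : AssocAlgebra C) • m = m}
  zero_mem' := smul_zero _
  add_mem' {a b} ha hb := by
    change _ = _
    rw [smul_add, show (idem y : AssocAlgebra C) • a = a from ha,
      show (idem y : AssocAlgebra C) • b = b from hb]
  neg_mem' {a} ha := by
    change _ = _
    rw [smul_neg, show (idem y : AssocAlgebra C) • a = a from ha]

variable {y}

lemma mem_corner {M : Type*} [AddCommGroup M] [Module (AssocAlgebra C) M] {m : M} :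
    m ∈ corner y M ↔ (idem y : AssocAlgebra C) • m = m := Iff.rfl

lemma idem_smul_mem_corner {M : Type*} [AddCommGroup M] [Module (AssocAlgebra C) M] (m : M) :
    (idem y : AssocAlgebra C) • m ∈ corner y M := by
  rw [mem_corner, smul_smul, idem_mul_idem]

instance (M : Type*) [AddCommGroup M] [Module (AssocAlgebra C) M] :
    Module (End y) (corner y M) where
  smul d m := ⟨(single (show y ⟶ y from d) : AssocAlgebra C) • m.1, by
    rw [mem_corner, smul_smul, idem_mul_single]⟩
  one_smul m := Subtype.ext (by
    change (single (𝟙 y) : AssocAlgebra C) • m.1 = m.1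
    rw [← idem_eq_single]
    exact m.2)
  mul_smul d e m := Subtype.ext (by
    change (single ((show y ⟶ y from e) ≫ (show y ⟶ y from d)) : AssocAlgebra C) • m.1 =
      (single (show y ⟶ y from d) : AssocAlgebra C) •
        (single (show y ⟶ y from e) : AssocAlgebra C) • m.1
    rw [smul_smul, single_mul_single])
  smul_zero d := Subtype.ext (smul_zero _)
  smul_add d m m' := Subtype.ext (smul_add _ _ _)
  add_smul d e m := Subtype.ext (by
    change (single ((show y ⟶ y from d) + (show y ⟶ y from e)) : AssocAlgebra C) • m.1 =
      (single (show y ⟶ y from d) : AssocAlgebra C) • m.1 +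
        (single (show y ⟶ y from e) : AssocAlgebra C) • m.1
    rw [single_add, add_smul])
  zero_smul m := Subtype.ext (by
    change (single (0 : y ⟶ y) : AssocAlgebra C) • m.1 = 0
    rw [single_zero, zero_smul])

/-! ### Exactness of M ↦ e_yM -/

section Map

variable {M' M M'' : Type*} [AddCommGroup M'] [Module (AssocAlgebra C) M'] [AddCommGroup M]
  [Module (AssocAlgebra C) M] [AddCommGroup M''] [Module (AssocAlgebra C) M'']

variable (y) in
/-- The map induced on the parts at `y`. -/
def cornerMap (f : M →ₗ[AssocAlgebra C] M'') : corner y M →ₗ[End y] corner y M'' where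
  toFun m := ⟨f m.1, by rw [mem_corner, ← map_smul, mem_corner.1 m.2]⟩
  map_add' _ _ := Subtype.ext (map_add f _ _)
  map_smul' _ _ := Subtype.ext (map_smul f _ _)

lemma cornerMap_injective {f : M →ₗ[AssocAlgebra C] M''} (hf : Function.Injective f) :
    Function.Injective (cornerMap y f) := fun _ _ h =>
  Subtype.ext (hf (congrArg Subtype.val h))

lemma cornerMap_surjective {f : M →ₗ[AssocAlgebra C] M''} (hf : Function.Surjective f) :
    Function.Surjective (cornerMap y f) := by
  intro m
  obtain ⟨a, ha⟩ := hf m.1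
  refine ⟨⟨_, idem_smul_mem_corner a⟩, Subtype.ext ?_⟩
  change f ((idem y : AssocAlgebra C) • a) = m.1
  rw [map_smul, ha, mem_corner.1 m.2]

lemma range_cornerMap {φ : M' →ₗ[AssocAlgebra C] M} {ψ : M →ₗ[AssocAlgebra C] M''}
    (h : LinearMap.range φ = LinearMap.ker ψ) :
    LinearMap.range (cornerMap y φ) = LinearMap.ker (cornerMap y ψ) := by
  ext m
  constructor
  · rintro ⟨a, rfl⟩
    refine Subtype.ext ?_
    change φ a.1 ∈ LinearMap.ker ψ
    rw [← h]
    exact ⟨_, rfl⟩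
  · intro hm
    have : m.1 ∈ LinearMap.ker ψ := congrArg Subtype.val hm
    rw [← h] at this
    obtain ⟨a, ha⟩ := this
    refine ⟨⟨_, idem_smul_mem_corner a⟩, Subtype.ext ?_⟩
    change φ ((idem y : AssocAlgebra C) • a) = m.1
    rw [map_smul, ha, mem_corner.1 m.2]

lemma projective_corner_of_exact {φ : M' →ₗ[AssocAlgebra C] M} {ψ : M →ₗ[AssocAlgebra C] M''}
    (hφ : Function.Injective φ) (hψ : Function.Surjective ψ)
    (h : LinearMap.range φ = LinearMap.ker ψ) (h1 : Module.Projective (End y) (corner y M'))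
    (h2 : Module.Projective (End y) (corner y M'')) : Module.Projective (End y) (corner y M) :=
  projective_of_exact (cornerMap y φ) (cornerMap y ψ) (cornerMap_injective hφ)
    (cornerMap_surjective hψ) (range_cornerMap h)

end Map

variable (y) in
/-- The part of `proj x` at `y` is the group of morphisms from `x` to `y`. -/
def cornerProjEquiv (x : C) : corner y (proj x) ≃ₗ[End y] (x ⟶ y) where
  toFun f := f.1.1 x y
  map_add' _ _ := rfl
  map_smul' d f := single_mul_apply (show y ⟶ y from d) f.1.1 x
  invFun g := ⟨⟨single g, single_mem_span_idem g⟩, Subtype.ext (idem_mul_single g)⟩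
  left_inv f := by
    refine Subtype.ext (Subtype.ext ?_)
    change single (f.1.1 x y) = f.1.1
    rw [← idem_mul_mul_idem, mul_assoc, mem_span_idem.1 f.1.2]
    exact congrArg Subtype.val f.2
  right_inv g := single_apply_self g

/-- If e_y m ≠ 0, then f : P_y → M, 1 ↦ m on the generator e_y up to e_y, is nonzero. Its kernel is
proper, hence inside the superfluous maximal submodule ker p, and f(P_y)/f(ker p) ≅ P_y/ker p ≅ S.
-/
lemma idem_smul_eq_zero_of_not_isCompositionFactor {M S : Type max w v} [AddCommGroup M]
    [Module (AssocAlgebra C) M] [AddCommGroup S] [Module (AssocAlgebra C) S]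
    [IsSimpleModule (AssocAlgebra C) S] {p : proj y →ₗ[AssocAlgebra C] S}
    (hp : IsProjectiveCover p) (h : ¬ IsCompositionFactor (AssocAlgebra C) M S) (m : M) :
    (idem y : AssocAlgebra C) • m = 0 := by
  by_contra hm
  apply h
  let f := projLift y m
  have hf : LinearMap.ker f ≠ ⊤ := fun h => hm (by
    have : projGen y ∈ LinearMap.ker f := h ▸ Submodule.mem_top
    exact this)
  have hle : LinearMap.ker f ≤ LinearMap.ker p := by
    have hco : IsCoatom (LinearMap.ker p) := isSimpleModule_iff_isCoatom.1
      (IsSimpleModule.congr (p.quotKerEquivOfSurjective hp.surjective))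
    by_contra hle
    exact hf (hp.superfluous _ (hco.2 _ (right_lt_sup.2 hle)))
  refine ⟨(LinearMap.ker p).map f, LinearMap.range f, LinearMap.map_le_range, ⟨?_⟩⟩
  let g := (((LinearMap.ker p).map f).submoduleOf (LinearMap.range f)).mkQ ∘ₗ f.rangeRestrict
  have hg : Function.Surjective g :=
    (Submodule.mkQ_surjective _).comp (LinearMap.surjective_rangeRestrict f)
  have hk : LinearMap.ker g = LinearMap.ker p := by
    rw [LinearMap.ker_comp, Submodule.ker_mkQ]
    change ((LinearMap.ker p).map f).comap f = _
    rw [Submodule.comap_map_eq, sup_eq_left.2 hle]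
  exact (g.quotKerEquivOfSurjective hg).symm.trans
    ((Submodule.quotEquivOfEq _ _ hk).trans (p.quotKerEquivOfSurjective hp.surjective))

end Corner

/-- If a directed category is standardly stratified, then its morphism groups are projective over
the endomorphism rings of their targets. -/
theorem projective_of_isStandardlyStratifiedCategory_le {C : Type w} [Category.{v} C]
    [Preadditive C] [Fintype C] [DecidableEq C] [PartialOrder C]
    (hC : IsDirectedCategory C (· ≤ ·)) (k : Type u) [Field k] [Linear k C]
    (h : IsStandardlyStratifiedCategory k C (· ≤ ·)) (x y : C) :
    Module.Projective (End y) (x ⟶ y) := by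
  obtain ⟨S, Δ, hS, -, -, hp, hΔ, hq⟩ := h.exists_standard
  choose p hp using hp
  choose q hq hK using hq
  -- For j < i this holds already in P_i, of which Δ_i is a quotient; for j ≰ i it is the condition
  -- on composition factors.
  have h1 : ∀ i j : C, j ≠ i → ∀ m : Δ i, (idem j : AssocAlgebra C) • m = 0 := by
    intro i j hji m
    by_cases hle : j ≤ i
    · obtain ⟨f, rfl⟩ := hq i m
      rw [← map_smul, idem_smul_proj_eq_zero hC (fun h => hji (le_antisymm hle h)), map_zero]
    · have := hS j
      exact idem_smul_eq_zero_of_not_isCompositionFactor (hp j) (hΔ i j hle) m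
  have h2 : ∀ i j : C, j ≠ i → Subsingleton (corner j (Δ i)) := fun i j hji =>
    subsingleton_of_forall_eq 0 fun m => Subtype.ext (by
      rw [← mem_corner.1 m.2]; exact h1 i j hji m.1)
  -- All factors Δ_j of K_i have j ≠ i, so e_i kills each of them. Hence e_iΔ_i ≅ e_iP_i is free of
  -- rank one.
  have h3 : ∀ i : C, Subsingleton (corner i (LinearMap.ker (q i))) := fun i =>
    (hK i).induction (P := fun M _ _ => Subsingleton (corner i M))
      (fun M _ _ _ => inferInstance) fun M' M _ _ _ _ j φ ψ hj hφ hψ hex hM' => by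
        have := h2 j i hj.2
        refine subsingleton_of_forall_eq 0 fun m => ?_
        have : m ∈ LinearMap.range (cornerMap i φ) := by
          rw [range_cornerMap hex]
          exact Subsingleton.elim _ _
        obtain ⟨a, rfl⟩ := this
        rw [Subsingleton.elim a 0, map_zero]
  have h4 : ∀ i : C, Module.Projective (End i) (corner i (Δ i)) := by
    intro i
    have : Module.Projective (End i) (i ⟶ i) :=
      inferInstanceAs (Module.Projective (End i) (End i))
    have : Module.Projective (End i) (corner i (proj i)) :=
      Module.Projective.of_equiv (cornerProjEquiv i i).symm
    refine Module.Projective.of_equiv (LinearEquiv.ofBijective (cornerMap i (q i))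
      ⟨?_, cornerMap_surjective (hq i)⟩)
    have := h3 i
    rw [← LinearMap.ker_eq_bot, ← range_cornerMap (LinearMap.ker (q i)).range_subtype,
      LinearMap.range_eq_bot]
    exact LinearMap.ext fun a => by rw [Subsingleton.elim a 0, map_zero, map_zero]
  have h5 : ∀ i j : C, Module.Projective (End i) (corner i (Δ j)) := by
    intro i j
    by_cases hij : i = j
    · subst hij; exact h4 i
    · have := h2 j i hij
      infer_instance
  have h6 : Module.Projective (End y) (corner y (LinearMap.ker (q x))) :=
    (hK x).induction (P := fun M _ _ => Module.Projective (End y) (corner y M))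
      (fun M _ _ _ => inferInstance) fun M' M _ _ _ _ j φ ψ hj hφ hψ hex hM' =>
        projective_corner_of_exact hφ hψ hex hM' (h5 y j)
  have h7 : Module.Projective (End y) (corner y (proj x)) :=
    projective_corner_of_exact (LinearMap.ker (q x)).injective_subtype (hq x)
      (LinearMap.ker (q x)).range_subtype h6 (h5 y x)
  exact Module.Projective.of_equiv (cornerProjEquiv y x)

end AssocAlgebra

/-! ### Ext groups of finitely generated modules over a finite-dimensional algebra -/

section Finite

open scoped ModuleCat

variable (k : Type u) [Field k] {A : Type u} [Ring A] [Algebra k A] [Module.Finite k A]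

lemma finite_hom (M N : ModuleCat.{u} A) [Module.Finite A M] [Module.Finite A N] :
    Module.Finite k (M ⟶ N) := by
  have : Module.Finite k M := Module.Finite.trans A M
  have : Module.Finite k N := Module.Finite.trans A N
  let φ : (M ⟶ N) →ₗ[k] (M →ₗ[k] N) :=
    { toFun := fun f => f.hom.restrictScalars k
      map_add' := fun _ _ => rfl
      map_smul' := fun _ _ => rfl }
  refine Module.Finite.of_injective φ fun f g h => ?_
  ext x
  exact LinearMap.congr_fun h x

/-- Cover M by a free module of finite rank: the kernel is again finitely generated, and its Ext^s
maps onto Ext^{s+1} of M. -/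
theorem finite_ext (M N : ModuleCat.{u} A) [Module.Finite A M] [Module.Finite A N] (s : ℕ) :
    Module.Finite k (Ext M N s) := by
  have : IsNoetherianRing A := IsNoetherianRing.of_finite k A
  induction s generalizing M with
  | zero =>
    have := finite_hom k M N
    exact Module.Finite.equiv (Ext.linearEquiv₀ (R := k) (X := M) (Y := N)).symm
  | succ s ih =>
    obtain ⟨n, f, hf⟩ := Module.Finite.exists_fin' A M
    let hS := LinearMap.shortExact_shortComplexKer hf
    exact Module.Finite.of_surjective (hS.extClass.precompOfLinear k N (add_comm 1 s))
      (precomp_extClass_surjective_of_projective_X₂ N hS s)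

end Finite

/-! ### Vanishing of Ext groups on filtered modules -/

section Vanishing

variable {A : Type u} [Ring A] {Λ : Type w} {Θ : Λ → ModuleCat.{u} A}

lemma ext_eq_zero_of_hasFiltration {I : Set Λ} {N : ModuleCat.{u} A} {s : ℕ}
    (h : ∀ i ∈ I, ∀ x : Ext (Θ i) N s, x = 0) {M : ModuleCat.{u} A}
    (hM : HasFiltration A Θ I M) (x : Ext M N s) : x = 0 :=
  hM.induction (P := fun M _ _ => ∀ x : Ext (ModuleCat.of A M) N s, x = 0)
    (fun M _ _ _ x => by
      have : 𝟙 (ModuleCat.of A M) = 0 :=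
        (ModuleCat.isZero_of_subsingleton (ModuleCat.of A M)).eq_of_src _ _
      rw [← Ext.mk₀_id_comp x, this, Ext.mk₀_zero, Ext.zero_comp])
    (fun M' M _ _ _ _ i φ ψ hi hφ hψ hex hM' x => by
      have hzero : ModuleCat.ofHom φ ≫ (ModuleCat.ofHom ψ : ModuleCat.of A M ⟶ Θ i) = 0 := by
        ext y
        change φ y ∈ LinearMap.ker ψ
        rw [← hex]
        exact ⟨y, rfl⟩
      let S : ShortComplex (ModuleCat.{u} A) := ShortComplex.mk _ _ hzero
      have hS : S.ShortExact := ModuleCat.shortComplex_shortExact S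
        (LinearMap.exact_iff.2 hex.symm) hφ hψ
      obtain ⟨y, rfl⟩ := Ext.contravariant_sequence_exact₂ hS N x (hM' _)
      rw [h i hi y, Ext.comp_zero]) x

/-- Dimension shift along a surjection with filtered kernel. -/
lemma ext_succ_eq_zero {Q X N : ModuleCat.{u} A} {q : Q →ₗ[A] X} (hq : Function.Surjective q)
    {I : Set Λ} (hK : HasFiltration A Θ I (LinearMap.ker q)) {s : ℕ}
    (h : ∀ i ∈ I, ∀ x : Ext (Θ i) N s, x = 0) (hQ : ∀ x : Ext Q N (s + 1), x = 0)
    (x : Ext X N (s + 1)) : x = 0 := by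
  have hS := LinearMap.shortExact_shortComplexKer hq
  obtain ⟨y, rfl⟩ := Ext.contravariant_sequence_exact₃ hS N x (hQ _) (add_comm 1 s)
  rw [ext_eq_zero_of_hasFiltration h (M := ModuleCat.of A (LinearMap.ker q)) hK y, Ext.comp_zero]

/-- Each Ext^s(Q_i, Θ_j) is a retract of the Ext^s of the direct sums, through the inclusions and
projections. -/
lemma ext_eq_zero_of_biproduct [Fintype Λ] {Q : Λ → ModuleCat.{u} A} {s : ℕ}
    (h : ∀ x : Ext (⨁ Q) (⨁ Θ) s, x = 0) (i j : Λ) (x : Ext (Q i) (Θ j) s) : x = 0 := by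
  classical
  have h1 : x = (Ext.mk₀ (biproduct.ι Q i)).comp
      (((Ext.mk₀ (biproduct.π Q i)).comp (x.comp (Ext.mk₀ (biproduct.ι Θ j)) (add_zero s))
        (zero_add s)).comp (Ext.mk₀ (biproduct.π Θ j)) (add_zero s)) (zero_add s) := by
    rw [Ext.comp_assoc_of_third_deg_zero, Ext.comp_assoc_of_third_deg_zero, Ext.mk₀_comp_mk₀,
      biproduct.ι_π_self, Ext.comp_mk₀_id, Ext.mk₀_comp_mk₀_assoc, biproduct.ι_π_self,
      Ext.mk₀_id_comp]
  rw [h1, h ((Ext.mk₀ (biproduct.π Q i)).comp _ _), Ext.zero_comp, Ext.comp_zero]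

end Vanishing

/-! ### Ext-projective stratifying systems -/

section Strat

variable {A : Type u} [Ring A] {Λ : Type w} [PartialOrder Λ] {Θ Q : Λ → ModuleCat.{u} A}
  (h : IsEPSS A Θ Q)

include h

lemma IsEPSS.ext_zero_eq_zero {i j : Λ} (hij : ¬ i ≤ j) (x : Ext (Θ i) (Θ j) 0) : x = 0 := by
  rw [← Ext.mk₀_homEquiv₀_apply x, h.hom_eq_zero i j hij (Ext.homEquiv₀ x), Ext.mk₀_zero]

section

variable (hQ : ∀ s : ℕ, 1 ≤ s → ∀ i j, ∀ x : Ext (Q i) (Θ j) s, x = 0)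

include hQ

lemma IsEPSS.ext_eq_zero_of_not_le (s : ℕ) : ∀ {i j : Λ}, ¬ i ≤ j → ∀ x : Ext (Θ i) (Θ j) s,
    x = 0 := by
  induction s with
  | zero => exact fun hij x => h.ext_zero_eq_zero hij x
  | succ s ih =>
    intro i j hij x
    obtain ⟨q, hq, hK⟩ := h.exists_cover i
    -- If i < l and i ≰ j, then l ≰ j, so the induction hypothesis applies to every factor of K_i.
    exact ext_succ_eq_zero hq hK (fun l hl => ih fun hlj => hij (hl.le.trans hlj))
      (hQ _ (by omega) i j) x

lemma IsEPSS.ext_succ_self_eq_zero (s : ℕ) (i : Λ) (x : Ext (Θ i) (Θ i) (s + 1)) : x = 0 := by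
  obtain ⟨q, hq, hK⟩ := h.exists_cover i
  exact ext_succ_eq_zero hq hK (fun l hl => h.ext_eq_zero_of_not_le hQ s hl.not_ge)
    (hQ _ (by omega) i i) x

/-- Each dimension shift moves to some l > i, with strictly fewer indices above it. This bounds the
degrees, as finite-dimensionality of the total Ext needs. -/
lemma IsEPSS.ext_eq_zero_of_card_lt [Fintype Λ] (s : ℕ) : ∀ {i : Λ} (j : Λ),
    Nat.card {l // i < l} < s → ∀ x : Ext (Θ i) (Θ j) s, x = 0 := by
  induction s with
  | zero => exact fun _ hi => absurd hi (Nat.not_lt_zero _)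
  | succ s ih =>
    intro i j hi x
    obtain ⟨q, hq, hK⟩ := h.exists_cover i
    refine ext_succ_eq_zero hq hK (fun l hl => ih j ?_) (hQ _ (by omega) i j) x
    have h1 : Nat.card {m // l < m} < Nat.card {m // i < m} :=
      Set.ncard_lt_ncard (s := {m | l < m}) (t := {m | i < m})
        (Set.ssubset_iff_of_subset (fun m hm => lt_trans hl hm) |>.2 ⟨l, hl, lt_irrefl l⟩)
        (Set.toFinite _)
    omega

end

lemma IsEPSS.isLocalRing_end [IsArtinianRing A] (i : Λ) : IsLocalRing (End (Θ i)) := by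
  obtain ⟨q, hq, hK⟩ := h.exists_cover i
  have := h.finite_right i
  have hloc := isLocalRing_end_of_indecomposable (h.indecomposable i)
  have hS := LinearMap.shortExact_shortComplexKer hq
  -- The obstruction to lifting g ∘ q through q lies in Ext¹(Q_i, K_i) = 0.
  have hlift : ∀ g : Θ i →ₗ[A] Θ i, ∃ f : Q i →ₗ[A] Q i, ∀ x, q (f x) = g (q x) := by
    intro g
    obtain ⟨y, hy⟩ := Ext.covariant_sequence_exact₃ (Q i) hS
      (Ext.mk₀ (ModuleCat.ofHom (g ∘ₗ q) : Q i ⟶ Θ i)) (zero_add 1)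
      (h.ext_one_eq_zero (ModuleCat.of A (LinearMap.ker q)) (hK.mono (Set.subset_univ _)) i _)
    obtain ⟨f, rfl⟩ := (Ext.mk₀_bijective _ _).2 y
    rw [Ext.mk₀_comp_mk₀] at hy
    have hy' := (Ext.mk₀_bijective _ _).1 hy
    exact ⟨f.hom, fun x => LinearMap.congr_fun (congrArg ModuleCat.Hom.hom hy') x⟩
  -- The map q ∘ f factors through q because Hom(K_i, Θ_i) = 0: every factor Θ_l of K_i has l > i.
  have hdesc : ∀ f : Q i →ₗ[A] Q i, ∃ g : Θ i →ₗ[A] Θ i, ∀ x, q (f x) = g (q x) := by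
    intro f
    obtain ⟨y, hy⟩ := Ext.contravariant_sequence_exact₂ hS (Θ i)
      (Ext.mk₀ (ModuleCat.ofHom (q ∘ₗ f) : Q i ⟶ Θ i))
      (ext_eq_zero_of_hasFiltration (fun l hl => h.ext_zero_eq_zero hl.not_ge)
        (M := ModuleCat.of A (LinearMap.ker q)) hK _)
    obtain ⟨g, rfl⟩ := (Ext.mk₀_bijective _ _).2 y
    rw [Ext.mk₀_comp_mk₀] at hy
    have hy' := (Ext.mk₀_bijective _ _).1 hy
    exact ⟨g.hom, fun x => (LinearMap.congr_fun (congrArg ModuleCat.Hom.hom hy') x).symm⟩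
  have hunit : ∀ (f : Q i →ₗ[A] Q i) (g : Θ i →ₗ[A] Θ i), (∀ x, q (f x) = g (q x)) →
      IsUnit (M := Module.End A (Q i)) f → IsUnit (M := Module.End A (Θ i)) g := by
    rintro _ g hfg ⟨u, rfl⟩
    obtain ⟨g', hg'⟩ := hdesc (↑u⁻¹ : Module.End A (Q i))
    refine ⟨⟨g, g', ?_, ?_⟩, rfl⟩
    · refine LinearMap.ext fun z => ?_
      obtain ⟨x, rfl⟩ := hq z
      change g (g' (q x)) = q x
      rw [← hg', ← hfg, ← Module.End.mul_apply, Units.mul_inv, Module.End.one_apply]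
    · refine LinearMap.ext fun z => ?_
      obtain ⟨x, rfl⟩ := hq z
      change g' (g (q x)) = q x
      rw [← hfg, ← hg', ← Module.End.mul_apply, Units.inv_mul, Module.End.one_apply]
  have := h.nonzero i
  have hΘ : IsLocalRing (Module.End A (Θ i)) := by
    refine IsLocalRing.of_isUnit_or_isUnit_one_sub_self fun g => ?_
    -- If f lifts g, then 1 - f lifts 1 - g; one of f and 1 - f is a unit, and units descend.
    obtain ⟨f, hf⟩ := hlift g
    refine (IsLocalRing.isUnit_or_isUnit_of_add_one (R := Module.End A (Q i))
      (add_sub_cancel f 1)).imp (hunit f g hf) (hunit _ _ fun x => ?_)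
    change q (x - f x) = q x - g (q x)
    rw [map_sub, hf]
  have : Nontrivial (End (Θ i)) := (ModuleCat.endRingEquiv (Θ i)).toEquiv.nontrivial
  exact isLocalRing_of_surjective (ModuleCat.endRingEquiv (Θ i)).symm.toRingHom
    (ModuleCat.endRingEquiv (Θ i)).symm.surjective

end Strat

/-! ### The category associated to the extension algebra -/

section ExtCategory

variable {A : Type u} [Ring A]

lemma finite_totalExt (k : Type u) [Field k] [Algebra k A] [Module.Finite k A]
    {M N : ModuleCat.{u} A} [Module.Finite A M] [Module.Finite A N] {n : ℕ}
    (h : ∀ s, n ≤ s → ∀ x : Ext M N s, x = 0) : Module.Finite k (TotalExt M N) := by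
  have := fun s => finite_ext k M N s
  let φ : TotalExt M N →ₗ[k] (∀ s : Fin n, Ext M N s) :=
    LinearMap.pi fun s => DirectSum.component k ℕ (fun s => Ext M N s) s
  refine Module.Finite.of_injective φ fun x y hxy => DFinsupp.ext fun s => ?_
  by_cases hs : s < n
  · exact congrFun hxy ⟨s, hs⟩
  · rw [h s (by omega) (x s), h s (by omega) (y s)]

lemma totalExt_eq_zero {M N : ModuleCat.{u} A} (h : ∀ s, ∀ x : Ext M N s, x = 0)
    (x : TotalExt M N) : x = 0 :=
  DFinsupp.ext fun s => h s (x s)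

/-- Identifies the degreewise action in the statement with composition in the Ext category. -/
lemma end_smul_eq_comp {M N : ModuleCat.{u} A} (f : End N) (x : TotalExt M N) :
    f • x = TotalExt.comp M N N x (DirectSum.of (fun n => Ext N N n) 0 (Ext.mk₀ f)) := by
  induction x using DirectSum.induction_on with
  | zero => simp
  | of s x =>
    rw [TotalExt.comp_of, TotalExt.of_comp_eq _ _ (add_zero s)]
    exact ((DirectSum.lof (End N) ℕ (fun n => Ext M N n) s).map_smul f x).symm
  | add x y hx hy => rw [smul_add, hx, hy, map_add, AddMonoidHom.add_apply]

variable {Λ : Type w} (Θ : Λ → ModuleCat.{u} A)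

/-- Endomorphisms of `Θ i`, as endomorphisms of degree zero in the category associated to the
extension algebra. -/
noncomputable def endHom (i : ExtCategory Θ) : End (Θ i) →+* End i where
  toFun f := DirectSum.of (fun n => Ext (Θ i) (Θ i) n) 0 (Ext.mk₀ f)
  map_one' := rfl
  map_mul' f g := by
    change _ = TotalExt.comp (Θ i) (Θ i) (Θ i) _ _
    rw [TotalExt.comp_of, TotalExt.of_comp_eq _ _ (add_zero 0), Ext.mk₀_comp_mk₀]
    rfl
  map_zero' := by
    change DirectSum.of (fun n => Ext (Θ i) (Θ i) n) 0 (Ext.mk₀ (0 : Θ i ⟶ Θ i)) = 0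
    rw [Ext.mk₀_zero, map_zero]
  map_add' f g := by
    change DirectSum.of (fun n => Ext (Θ i) (Θ i) n) 0
      (Ext.mk₀ ((f : Θ i ⟶ Θ i) + (g : Θ i ⟶ Θ i))) = _
    rw [Ext.mk₀_add, map_add]

variable {Θ}

lemma endHom_bijective {i : ExtCategory Θ} (h : ∀ s, ∀ x : Ext (Θ i) (Θ i) (s + 1), x = 0) :
    Function.Bijective (endHom Θ i) := by
  refine ⟨fun f g hfg => (Ext.mk₀_bijective _ _).1 (DirectSum.of_injective 0 hfg), fun x => ?_⟩
  obtain ⟨f, hf⟩ := (Ext.mk₀_bijective _ _).2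
    ((show DirectSum ℕ (fun n => Ext (Θ i) (Θ i) n) from x) 0)
  refine ⟨f, ?_⟩
  change DirectSum.of (fun n => Ext (Θ i) (Θ i) n) 0 (Ext.mk₀ f) = x
  refine DFinsupp.ext fun s => ?_
  cases s with
  | zero => rw [hf]; exact DirectSum.of_eq_same _ _
  | succ s => exact (h s _).trans (h s _).symm

/-- The endomorphism rings of `Θ i` and of the object `i` agree if `Θ i` has no
self-extensions. -/
noncomputable def endEquiv {i : ExtCategory Θ} (h : ∀ s, ∀ x : Ext (Θ i) (Θ i) (s + 1), x = 0) :
    End (Θ i) ≃+* End i :=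
  RingEquiv.ofBijective (endHom Θ i) (endHom_bijective h)

/-- A direct sum is projective exactly when its summands are; the identity map is semilinear over
the isomorphism of endomorphism rings. -/
lemma projective_hom_iff {i j : ExtCategory Θ} (h : ∀ s, ∀ x : Ext (Θ j) (Θ j) (s + 1), x = 0) :
    Module.Projective (End j) (i ⟶ j) ↔
      ∀ s, Module.Projective (End (Θ j)) (Ext (Θ i) (Θ j) s) := by
  rw [← Module.Projective.directSum_iff]
  have := RingHomInvPair.of_ringEquiv (endEquiv h)
  have := RingHomInvPair.of_ringEquiv (endEquiv h).symm
  let e : DirectSum ℕ (fun s => Ext (Θ i) (Θ j) s) ≃ₛₗ[(endEquiv h : End (Θ j) →+* End j)] (i ⟶ j) :=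
    { AddEquiv.refl (TotalExt (Θ i) (Θ j)) with
      map_smul' := fun f x => end_smul_eq_comp f x }
  exact ⟨fun _ => Module.Projective.of_equiv e.symm, fun _ => Module.Projective.of_equiv e⟩

end ExtCategory

end ExtStrat

theorem theorem1p11 {k : Type u} [Field k] {A : Type u} [Ring A] [Algebra k A]
    [Module.Finite k A] {Λ : Type w} [PartialOrder Λ] [Fintype Λ] [DecidableEq Λ]
    (Θ Q : Λ → ModuleCat.{u} A) (hΘQ : ExtStrat.IsEPSS A Θ Q)
    (hExt : ∀ i : ℕ, 1 ≤ i → ∀ x : Ext (⨁ Q) (⨁ Θ) i, x = 0) :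
    ExtStrat.IsDirectedCategory (ExtStrat.ExtCategory Θ) (· ≤ ·) ∧
    ExtStrat.IsStandardlyStratifiedCategory k (ExtStrat.ExtCategory Θ) (· ≥ ·) ∧
    (ExtStrat.IsStandardlyStratifiedCategory k (ExtStrat.ExtCategory Θ) (· ≤ ·) ↔
      ∀ (s : ℕ) (l m : Λ), Module.Projective (End (Θ m)) (Ext (Θ l) (Θ m) s)) := by
  have hQ : ∀ s : ℕ, 1 ≤ s → ∀ i j, ∀ x : Ext (Q i) (Θ j) s, x = 0 := fun s hs =>
    ExtStrat.ext_eq_zero_of_biproduct (hExt s hs)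
  have hself := fun i s => hΘQ.ext_succ_self_eq_zero hQ s i
  have hC : ExtStrat.IsDirectedCategory (ExtStrat.ExtCategory Θ) (· ≤ ·) := fun i j hij f =>
    ExtStrat.totalExt_eq_zero (fun s => hΘQ.ext_eq_zero_of_not_le hQ s hij) f
  have hfin : ∀ i j : ExtStrat.ExtCategory Θ, Module.Finite k (i ⟶ j) := fun i j => by
    have := hΘQ.finite_left i
    have := hΘQ.finite_left j
    exact ExtStrat.finite_totalExt k (M := Θ i) (N := Θ j)
      -- The degree bound is one more than the number of indices strictly above i.
      fun s hs => hΘQ.ext_eq_zero_of_card_lt hQ s j (Nat.lt_of_succ_le hs)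
  have hloc : ∀ i : ExtStrat.ExtCategory Θ, IsLocalRing (End i) := fun i => by
    have : IsArtinianRing A := IsArtinianRing.of_finite k A
    have := hΘQ.isLocalRing_end i
    have : Nontrivial (End i) := (ExtStrat.endEquiv (hself i)).symm.toEquiv.nontrivial
    exact ExtStrat.isLocalRing_of_surjective (ExtStrat.endEquiv (hself i)).toRingHom
      (ExtStrat.endEquiv (hself i)).surjective
  refine ⟨hC, ExtStrat.AssocAlgebra.isStandardlyStratifiedCategory_ge hC hloc k hfin,
    fun h s l m => ?_, fun h => ?_⟩
  · exact (ExtStrat.projective_hom_iff (hself m)).1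
      (ExtStrat.AssocAlgebra.projective_of_isStandardlyStratifiedCategory_le hC k h l m) s
  · exact ExtStrat.AssocAlgebra.isStandardlyStratifiedCategory_le_of_projective hC hloc k hfin
      fun l m => (ExtStrat.projective_hom_iff (hself m)).2 fun s => h s l m
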